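/- **Dynamic list update.** An algorithm maintains a list of distinct items, starting from a given finite list $L_0$ (locations are numbered $1,2,\dots$ from the front). The input $\sigma$ is a finite sequence of requests: an access to a present item, an insertion of an absent item, or a deletion of a present item. Accessing the item in location $\ell$ costs $\ell-1+a$; afterwards the algorithm may perform any number of swaps of neighboring items, each of cost $1$. Inserting an item places it at the end of the list and costs $\iota(n)$, where $n$ is the length of the list before the insertion; afterwards swaps of cost $1$ are allowed. Deleting an item consists of accessing it at cost $\ell-1+d$, then optional swaps of cost $1$, and then its removal. Here $a,d\in\mathbb N$ and $\iota:\mathbb N\to\mathbb N$ describe the cost convention ($a=d=0$ are partial costs, $a=d=1$ full costs, $\iota(n)=n$ or $n+1$ is the usual insertion cost, $\iota=0$ is the adjusted cost that ignores insertions). $\mathrm{Opt}(\sigma)$ is the minimum total cost of serving $\sigma$ from $L_0$. Write $x\prec y$ if $x$ is before $y$ in the list. **Pairs.** A pair $\{x,y\}$, $x\ne y$, is active while both items are in the list. While it is active, $W^{xy}(xy)$ (resp. $W^{xy}(yx)$) is the minimum cost, with access cost $\ell-1$ and swap cost $1$, of a solution on a two-item list that starts in the order that $x,y$ had when the pair became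 active, serves the accesses to $x$ and $y$ made since then (including those that are part of a deletion), and ends in configuration $xy$ (resp. $yx$); swaps are also allowed before the first access. Let $y\prec x$. The mode of the pair is $\alpha$, $\beta$, $\gamma$ if $W^{xy}(yx)-W^{xy}(xy)$ is $-1$, $0$, $1$, respectively. With targets $\theta_x\preceq x$, $\theta_y\preceq y$ maintained as below, its flavor is $d$ if $y\prec\theta_x$, $o$ if $\theta_y\prec\theta_x\preceq y$, $e$ if $\theta_x=\theta_y$, and $n$ if $\theta_x\prec\theta_y$. The potential $\Phi_{xy}$ of an active pair with mode $\xi$ and flavor $\omega$ is $\xi^\omega$, where $$\alpha^d=0,\quad \alpha^o=\alpha^e=2,\quad \beta^d=\tfrac{5+3\sqrt{17}}{16},\quad \beta^o=\tfrac{1+7\sqrt{17}}{16},\quad \beta^n=\beta^e=\tfrac{9-\sqrt{17}}{16},\quad \gamma^n=\gamma^e=2$$ (the states $\alpha^n,\gamma^d,\gamma^o$ do not occur; their value is set to $0$). The potential of a pair is $0$ before it becomes active for the first time, and it is frozen when the pair stops being active. **Algorithm FPM.** Initially $\theta_x=x$ for all $x$. On an access to $z$: (1) every $y\neq z$ with $\theta_y=z$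 gets the successor of $z$ as its new target; (2) $z$ is moved, either to the front (full move) or to the place right before $\theta_z$ (partial move; no movement if $\theta_z=z$); (3) $\theta_z$ is set to the front item. FPM chooses the move for which the cost of the step plus $\sum_{y\prec z}\Delta\Phi_{zy}$ is smaller, where the sum is over the items preceding $z$ before the move and $\Delta\Phi_{zy}$ is the change of potential caused by the step; ties are broken arbitrarily. An insertion of $z$ triggers no reorganization, and sets $\theta_z=z$. A deletion of $z$ is treated as an access to $z$ (with the corresponding move) followed by the removal of $z$. An item that is inserted again after a deletion is treated as a new item. **Theorem.** Let $R=\frac{23+\sqrt{17}}8$. Then $R\le 3.3904$, and for every initial list, every valid request sequence $\sigma$, every way of breaking ties and every cost convention $(a,d,\iota)$ as above, $$\mathrm{FPM}(\sigma)\le R\cdot \mathrm{Opt}(\sigma),$$ so the competitive ratio of FPM in the dynamic variant is at most $R$. Moreover, in every situation reached by FPM, neither the insertion of an item that was never in the list before nor the actual removal of an item (after the access that is part of its deletion) changes the potential of any pair. -/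

import Mathlib

namespace ListUpdate

/-! ## The dynamic list update problem with uniform swap cost -/

/-- A request: an access to `z`, an insertion of `z`, or a deletion of `z`. -/
inductive Request (α : Type*) where
  | access (z : α)
  | insert (z : α)
  | delete (z : α)

/-- The cost conventions.  Accessing the item in location `ℓ = 1, 2, …` costs
`ℓ - 1 + accessOffset`, the access that is part of a deletion costs `ℓ - 1 + deleteOffset`, and an
insertion into a list of length `n` costs `insertCost n`.  For example, offsets `0` and
`insertCost n = n` give partial costs, offsets `1` and `insertCost n = n + 1` give full
costs, and `insertCost n = 0` gives the adjusted cost, which ignores insertions. -/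
structure CostModel where
  accessOffset : ℕ
  deleteOffset : ℕ
  insertCost : ℕ → ℕ

variable {α : Type*} [DecidableEq α]

/-- `Swaps L k L'`: the list `L'` arises from `L` by `k` swaps of neighboring items. -/
inductive Swaps : List α → ℕ → List α → Prop
  | refl (L : List α) : Swaps L 0 L
  | swap (L A B : List α) (x y : α) (k : ℕ) :
      Swaps L k (A ++ x :: y :: B) → Swaps L (k + 1) (A ++ y :: x :: B)

/-- `Step M L r c L'`: an algorithm whose list is `L` may serve the request `r` at total cost `c`,
ending with the list `L'`. `L.idxOf z` is the location of `z` minus one. -/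
def Step (M : CostModel) (L : List α) (r : Request α) (c : ℕ) (L' : List α) : Prop :=
  match r with
  | .access z => z ∈ L ∧ ∃ k, Swaps L k L' ∧ c = L.idxOf z + M.accessOffset + k
  | .insert z => z ∉ L ∧ ∃ k, Swaps (L ++ [z]) k L' ∧ c = M.insertCost L.length + k
  | .delete z => z ∈ L ∧ ∃ k L₁, Swaps L k L₁ ∧ L' = L₁.erase z ∧
      c = L.idxOf z + M.deleteOffset + k

/-- `Serves M L σ c L'`: starting with the list `L`, the sequence `σ` may be served at total
cost `c`, ending with the list `L'`. -/
inductive Serves (M : CostModel) : List α → List (Request α) → ℕ → List α → Prop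
  | nil (L : List α) : Serves M L [] 0 L
  | cons (L L₁ L₂ : List α) (r : Request α) (σ : List (Request α)) (c d : ℕ) :
      Step M L r c L₁ → Serves M L₁ σ d L₂ → Serves M L (r :: σ) (c + d) L₂

/-- The optimal offline cost of serving `σ` from the initial list `L`. -/
noncomputable def opt (M : CostModel) (L : List α) (σ : List (Request α)) : ℕ :=
  sInf {c | ∃ L', Serves M L σ c L'}

/-- Only present items are accessed or deleted, and only absent items are inserted.  (The order of
the items in the list argument is irrelevant here.) -/
def Valid : List α → List (Request α) → Prop
  | _, [] => True
  | L, .access z :: σ => z ∈ L ∧ Valid L σ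
  | L, .insert z :: σ => z ∉ L ∧ Valid (L ++ [z]) σ
  | L, .delete z :: σ => z ∈ L ∧ Valid (L.erase z) σ

/-! ## Work functions of pairs -/

/-- `PairSolution I h C k`: there is a solution on a two-item list that starts in configuration `I`,
serves the accesses in `h` (most recent access first), ends in configuration `C` and has
total (partial) cost `k`. -/
inductive PairSolution (I : List α) : List α → List α → ℕ → Prop
  | start : PairSolution I [] I 0
  | swap (h : List α) (x y : α) (k : ℕ) :
      PairSolution I h [x, y] k → PairSolution I h [y, x] (k + 1)
  | access (h C : List α) (z : α) (k : ℕ) :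
      PairSolution I h C k → PairSolution I (z :: h) C (k + C.idxOf z)

/-- The work function of a pair that started in configuration `I` and received the accesses `h`
(most recent first), evaluated at configuration `C`. -/
noncomputable def workFunction (I h C : List α) : ℕ :=
  sInf {k | PairSolution I h C k}

/-! ## Algorithm Full-Or-Partial-Move -/

/-- The three modes `α`, `β`, `γ`. -/
inductive Mode where
  | a | b | c

/-- The four flavors: disjoint, overlapping, equal, nested. -/
inductive Flavor where
  | d | o | e | n

/-- The potential assigned to each pair state.  (The combinations `α^n`, `γ^d`, `γ^o` do not
occur; they get the value `0`.) -/
noncomputable def stateValue : Mode → Flavor → ℝ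
  | .a, .d => 0
  | .b, .d => (5 + 3 * √17) / 16
  | .a, .o => 2
  | .a, .e => 2
  | .b, .o => (1 + 7 * √17) / 16
  | .b, .e => (9 - √17) / 16
  | .b, .n => (9 - √17) / 16
  | .c, .e => 2
  | .c, .n => 2
  | .a, .n => 0
  | .c, .d => 0
  | .c, .o => 0

/-- What FPM remembers: its list, the target `θ x` of each item `x`, and for each
pair `{x, y}`, the two-item configuration at the beginning of the current active period (`init x y`),
the requests to `x` or `y` in that period, most recent first (`hist x y`), and the value of the
potential of the pair while it is not active (`stored x y`). -/
structure State (α : Type*) where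
  list : List α
  target : α → α
  init : α → α → List α
  hist : α → α → List α
  stored : α → α → ℝ

namespace State

/-- The initial state with list `L`. -/
def initial (L : List α) : State α where
  list := L
  target := id
  init x y := if L.idxOf x < L.idxOf y then [x, y] else [y, x]
  hist _ _ := []
  stored _ _ := 0

/-- The current value `W^{xy}(xy)`. -/
noncomputable def work (s : State α) (x y : α) : ℕ :=
  workFunction (s.init x y) (s.hist x y) [x, y]

/-- The mode of the pair `{x, y}`, where `y` precedes `x` in the list. -/
noncomputable def mode (s : State α) (y x : α) : Mode :=
  if s.work y x + 1 = s.work x y then .a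
  else if s.work y x = s.work x y then .b
  else .c

/-- The location (minus one) of an item in the list. -/
def pos (s : State α) (x : α) : ℕ := s.list.idxOf x

/-- The flavor of the pair `{x, y}`, where `y` precedes `x` in the list. -/
def flavor (s : State α) (y x : α) : Flavor :=
  if s.pos y < s.pos (s.target x) then .d
  else if s.pos (s.target y) < s.pos (s.target x) then .o
  else if s.target y = s.target x then .e
  else .n

/-- The pair potential `Φ_{xy}` for `x ≠ y`.  While both items are in the list (the pair is active),
it is the value of the state of the pair; otherwise it is the stored value, which
is zero before the first active period. -/
noncomputable def potential (s : State α) (x y : α) : ℝ :=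
  if x ∈ s.list ∧ y ∈ s.list then
    if s.pos y < s.pos x then stateValue (s.mode y x) (s.flavor y x)
    else stateValue (s.mode x y) (s.flavor x y)
  else s.stored x y

/-- The location (minus one) to which the accessed item `z` is moved: the front in a full move, and
the location of the target of `z` in a partial move. -/
def dest (s : State α) (z : α) (full : Bool) : ℕ :=
  if full then 0 else s.pos (s.target z)

/-- The list after moving `z` to its destination. -/
def movedList (s : State α) (z : α) (full : Bool) : List α :=
  (s.list.erase z).insertIdx (s.dest z full) z

/-- The state after an access to `z` served with the given kind of move: the request is recorded for
the active pairs containing `z`; items other than `z` that target `z` now target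
the successor of `z`; `z` is moved; the target of `z` becomes the front item. -/
def afterAccess (s : State α) (z : α) (full : Bool) : State α where
  list := s.movedList z full
  target x :=
    if x = z then (s.movedList z full).headD z
    else if s.target x = z then s.list.getD (s.pos z + 1) z
    else s.target x
  init := s.init
  hist x y :=
    if x ∈ s.list ∧ y ∈ s.list ∧ (x = z ∨ y = z) then z :: s.hist x y else s.hist x y
  stored := s.stored

/-- The partial cost of accessing `z` plus the number of swaps of the given move. -/
def moveCost (s : State α) (z : α) (full : Bool) : ℕ :=
  s.pos z + (s.pos z - s.dest z full)

/-- The quantity minimized by FPM: the cost of the step plus the change of the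
potentials of the pairs `{z, y}` over all items `y` preceding `z`.  (A constant
added to the access cost would not influence the choice.) -/
noncomputable def objective (s : State α) (z : α) (full : Bool) : ℝ :=
  s.moveCost z full +
    ((s.list.take (s.pos z)).map fun y =>
      (s.afterAccess z full).potential z y - s.potential z y).sum

open Classical in
/-- The move chosen by FPM (`true` for a full move); `tie` decides between equally good moves. -/
noncomputable def choice (s : State α) (z : α) (tie : Bool) : Bool :=
  if s.objective z true < s.objective z false then true
  else if s.objective z false < s.objective z true then false
  else tie

/-- The state after FPM served an access to `z`. -/
noncomputable def serveAccess (s : State α) (z : α) (tie : Bool) : State α :=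
  s.afterAccess z (s.choice z tie)

/-- The state after inserting `z` at the end of the list, without reorganization. All pairs
containing `z` start anew. -/
def insertItem (s : State α) (z : α) : State α where
  list := s.list ++ [z]
  target x := if x = z then z else s.target x
  init x y := if y = z then [x, z] else if x = z then [y, z] else s.init x y
  hist x y := if x = z ∨ y = z then [] else s.hist x y
  stored := s.stored

/-- The state after the actual removal of `z`.  Potentials of pairs that stop being active are frozen;
the stored values of pairs that stay active are not used. -/
noncomputable def removeItem (s : State α) (z : α) : State α where
  list := s.list.erase z
  target := s.target
  init := s.init
  hist := s.hist
  stored x y := s.potential x y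

/-- One step of FPM. -/
noncomputable def step (s : State α) (r : Request α) (tie : Bool) : State α :=
  match r with
  | .access z => s.serveAccess z tie
  | .insert z => s.insertItem z
  | .delete z => (s.serveAccess z tie).removeItem z

/-- The cost of FPM in one step. -/
noncomputable def stepCost (M : CostModel) (s : State α) (r : Request α) (tie : Bool) : ℕ :=
  match r with
  | .access z => s.moveCost z (s.choice z tie) + M.accessOffset
  | .insert _ => M.insertCost s.list.length
  | .delete z => s.moveCost z (s.choice z tie) + M.deleteOffset

/-- The state of FPM after serving a sequence; `tie i` breaks a tie in the `i`-th step (from `0`). -/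
noncomputable def run (tie : ℕ → Bool) (s : State α) : List (Request α) → State α
  | [] => s
  | r :: σ => run (fun i => tie (i + 1)) (s.step r (tie 0)) σ

/-- The total cost of FPM on a sequence. -/
noncomputable def cost (M : CostModel) (tie : ℕ → Bool) (s : State α) : List (Request α) → ℕ
  | [] => 0
  | r :: σ => s.stepCost M r (tie 0) + cost M (fun i => tie (i + 1)) (s.step r (tie 0)) σ

end State

end ListUpdate

namespace ListUpdate

/-! FPM is compared with an arbitrary solution whose current list is `L`. For an active pair, the
excess is the work function at the order in `L` minus (W(xy) + W(yx) - 1)/2. `totalPotential` sums Φ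
+ R · excess over the active pairs. It vanishes at the start and is never negative, so it suffices
that in every step FPM's cost plus the change of this sum is at most R times the cost of the
solution (`amortized_step`).

On an access to z, the average of W(zy) and W(yz) grows by `budget`, while the work function at the
order in `L` grows by at most what the solution pays for y (`excess_afterAccess_le`). What remains
is FPM's cost + ΔΦ ≤ R · (sum of budgets). Pairs without z do not gain potential, and an item behind
z is covered by its own budget (`stateValue_hitFirst_le`). For an item before z, either move may
exceed the budget in some state, but the convex combination giving the full move weight `fullWeight`
never does (`average_contribution_le`). FPM takes the cheaper move after summation, hence does at
least as well as this average.

A swap by the solution changes the excess of one pair, by at most 1. An insertion creates pairs of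
value 0. A removal discards nonnegative terms and leaves the other pairs unchanged, because no
remaining item targets the removed one. -/

theorem Swaps.perm {α : Type*} {L L' : List α} {k : ℕ} (h : Swaps L k L') : L'.Perm L := by
  induction h with
  | refl => exact List.Perm.refl _
  | swap A B x y k _ ih => exact ((List.Perm.swap x y B).append_left A).trans ih

variable {α : Type*} [DecidableEq α]

/-! ## Positions in lists -/

theorem exists_split_of_le_idxOf {l : List α} {z : α} (hz : z ∈ l) {d : ℕ}
    (hd : d ≤ l.idxOf z) :
    ∃ A₁ A₂ B, l = A₁ ++ (A₂ ++ z :: B) ∧ A₁.length = d ∧ A₁.length + A₂.length = l.idxOf z := by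
  have hlt : l.idxOf z < l.length := List.idxOf_lt_length_of_mem hz
  refine ⟨l.take d, (l.drop d).take (l.idxOf z - d), l.drop (l.idxOf z + 1), ?_, ?_, ?_⟩
  · have h1 : (l.drop (l.idxOf z)) = z :: l.drop (l.idxOf z + 1) := by
      rw [List.drop_eq_getElem_cons hlt, List.getElem_idxOf]
    have h2 : (l.drop d).drop (l.idxOf z - d) = l.drop (l.idxOf z) := by
      rw [List.drop_drop]; congr 1; omega
    rw [← h1, ← h2, List.take_append_drop, List.take_append_drop]
  · rw [List.length_take]; omega
  · rw [List.length_take, List.length_take, List.length_drop]; omega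

theorem erase_insertIdx_eq {A₁ A₂ B : List α} {z : α}
    (h : (A₁ ++ (A₂ ++ z :: B)).Nodup) :
    ((A₁ ++ (A₂ ++ z :: B)).erase z).insertIdx A₁.length z = A₁ ++ z :: (A₂ ++ B) := by
  have h1 : z ∉ A₁ := by grind
  have h2 : z ∉ A₂ := by grind
  rw [List.erase_append_right _ h1, List.erase_append_right _ h2, List.erase_cons_head]
  clear h h1 h2
  induction A₁ with
  | nil => simp
  | cons a A ih => simpa using ih

theorem perm_erase_insertIdx {l : List α} {z : α} (hz : z ∈ l) {d : ℕ}
    (hd : d ≤ l.idxOf z) : ((l.erase z).insertIdx d z).Perm l := by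
  have h : d ≤ (l.erase z).length := by
    have := List.idxOf_lt_length_of_mem hz
    rw [List.length_erase_of_mem hz]; omega
  exact (List.perm_insertIdx z _ h).trans (List.perm_cons_erase hz).symm

theorem idxOf_erase_insertIdx_self {l : List α} (hl : l.Nodup) {z : α} (hz : z ∈ l) {d : ℕ}
    (hd : d ≤ l.idxOf z) : ((l.erase z).insertIdx d z).idxOf z = d := by
  obtain ⟨A₁, A₂, B, rfl, rfl, -⟩ := exists_split_of_le_idxOf hz hd
  rw [erase_insertIdx_eq hl]
  have h1 : z ∉ A₁ := by grind
  simp [List.idxOf_append, h1]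

theorem idxOf_erase_insertIdx_of_ne {l : List α} (hl : l.Nodup) {z : α} (hz : z ∈ l) {d : ℕ}
    (hd : d ≤ l.idxOf z) {u : α} (hu : u ≠ z) :
    ((l.erase z).insertIdx d z).idxOf u =
      l.idxOf u + if d ≤ l.idxOf u ∧ l.idxOf u < l.idxOf z then 1 else 0 := by
  obtain ⟨A₁, A₂, B, rfl, rfl, h3⟩ := exists_split_of_le_idxOf hz hd
  rw [erase_insertIdx_eq hl, ← h3]
  by_cases h1 : u ∈ A₁
  · have := List.idxOf_lt_length_of_mem h1
    simp [List.idxOf_append, h1, this]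
  by_cases h2 : u ∈ A₂
  · have := List.idxOf_lt_length_of_mem h2
    simp only [List.idxOf_append, h1, h2, List.idxOf_cons_ne _ hu.symm, if_true, if_false]
    rw [if_pos (by omega)]
    omega
  · have hb : (z == u) = false := by simpa using hu.symm
    simp only [List.idxOf_append, h1, h2, List.idxOf_cons, hb, cond_false, if_false]
    rw [if_neg (by omega)]
    omega

/-- Turns positions into counts of items, so that access and swap costs can be distributed over
pairs. -/
theorem card_filter_idxOf_lt {l : List α} (hl : l.Nodup) {k : ℕ} (hk : k ≤ l.length) :
    (l.toFinset.filter fun y => l.idxOf y < k).card = k := by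
  have : (l.toFinset.filter fun y => l.idxOf y < k) = (l.take k).toFinset := by
    ext y
    simp only [Finset.mem_filter, List.mem_toFinset]
    constructor
    · rintro ⟨h1, h2⟩; exact (List.mem_take_iff_idxOf_lt h1).2 h2
    · intro h
      have := List.mem_of_mem_take h
      exact ⟨this, (List.mem_take_iff_idxOf_lt this).1 h⟩
  rw [this, List.toFinset_card_of_nodup (hl.sublist (List.take_sublist _ _)), List.length_take]
  omega

theorem idxOf_erase_lt_idxOf_erase {l : List α} {z u v : α} (hu : u ≠ z)
    (hv : v ≠ z) : (l.erase z).idxOf u < (l.erase z).idxOf v ↔ l.idxOf u < l.idxOf v := by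
  induction l with
  | nil => simp
  | cons a l ih =>
    by_cases ha : a = z
    · subst ha
      simp [hu.symm, hv.symm]
    · rw [List.erase_cons_tail (by simpa using ha)]
      by_cases hau : a = u <;> by_cases hav : a = v <;> grind

theorem idxOf_swap {A B : List α} {x y : α} (h : (A ++ x :: y :: B).Nodup) {u v : α}
    (hne : u ≠ v) (h1 : ¬ (u = x ∧ v = y)) (h2 : ¬ (u = y ∧ v = x)) :
    (A ++ y :: x :: B).idxOf u < (A ++ y :: x :: B).idxOf v ↔
      (A ++ x :: y :: B).idxOf u < (A ++ x :: y :: B).idxOf v := by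
  have hA : ∀ w, w ∈ A → A.idxOf w < A.length := fun w => List.idxOf_lt_length_of_mem
  have hxA : x ∉ A := by grind
  have hyA : y ∉ A := by grind
  have hxy : x ≠ y := by grind
  -- In both lists x and y fill the positions `A.length` and `A.length + 1`; every other item keeps
  -- its position outside this window.
  have key : ∀ w, w ≠ x → w ≠ y →
      ((A ++ y :: x :: B).idxOf w = (A ++ x :: y :: B).idxOf w ∧
        ((A ++ x :: y :: B).idxOf w < A.length ∨ A.length + 2 ≤ (A ++ x :: y :: B).idxOf w)) := by
    intro w hx hy
    by_cases hw : w ∈ A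
    · simp [List.idxOf_append, hw, hA w hw]
    · simp [List.idxOf_append, hw, hx.symm, hy.symm]
      omega
  have k1 : (A ++ x :: y :: B).idxOf x = A.length := by simp [List.idxOf_append, hxA]
  have k2 : (A ++ x :: y :: B).idxOf y = A.length + 1 := by
    simp [List.idxOf_append, hyA, hxy]; omega
  have k3 : (A ++ y :: x :: B).idxOf y = A.length := by simp [List.idxOf_append, hyA]
  have k4 : (A ++ y :: x :: B).idxOf x = A.length + 1 := by
    simp [List.idxOf_append, hxA, hxy.symm]; omega
  by_cases hux : u = x <;> by_cases huy : u = y <;> by_cases hvx : v = x <;>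
    by_cases hvy : v = y <;> grind

/-! ## Work functions of pairs -/

theorem PairSolution.exists_cost {x y : α} {I : List α} (hI : I = [x, y] ∨ I = [y, x])
    (h : List α) : ∃ k, PairSolution I h [x, y] k := by
  induction h with
  | nil =>
    rcases hI with rfl | rfl
    · exact ⟨0, .start⟩
    · exact ⟨_, .swap _ _ _ _ .start⟩
  | cons z h ih =>
    obtain ⟨k, hk⟩ := ih
    exact ⟨_, .access _ _ z _ hk⟩

theorem workFunction_le {I h C : List α} {k : ℕ} (H : PairSolution I h C k) :
    workFunction I h C ≤ k := Nat.sInf_le H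

theorem pairSolution_workFunction {x y : α} {I : List α} (hI : I = [x, y] ∨ I = [y, x])
    (h : List α) : PairSolution I h [x, y] (workFunction I h [x, y]) :=
  Nat.sInf_mem (s := {k | PairSolution I h [x, y] k}) (PairSolution.exists_cost hI h)

theorem workFunction_swap_le {x y : α} {I : List α} (hI : I = [x, y] ∨ I = [y, x])
    (h : List α) : workFunction I h [x, y] ≤ workFunction I h [y, x] + 1 :=
  workFunction_le (.swap _ _ _ _ (pairSolution_workFunction hI.symm h))

theorem workFunction_nil_self (I : List α) : workFunction I [] I = 0 :=
  Nat.le_zero.1 (workFunction_le .start)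

theorem PairSolution.eq_of_zero {I C : List α} (H : PairSolution I [] C 0) : C = I := by
  cases H
  rfl

theorem workFunction_nil_swap {x y : α} (hxy : x ≠ y) : workFunction [x, y] [] [y, x] = 1 := by
  have h1 : workFunction [x, y] [] [y, x] ≤ 1 := workFunction_le (.swap _ _ _ _ .start)
  have h2 := pairSolution_workFunction (x := y) (y := x) (I := [x, y]) (Or.inr rfl) []
  rcases Nat.lt_or_ge (workFunction [x, y] [] [y, x]) 1 with h | h
  · rw [Nat.lt_one_iff.1 h] at h2
    have := h2.eq_of_zero
    simp_all
  · omega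

/-- After the last access only swaps can follow, and one swap exchanges `C` with `C.reverse` at cost
1, so the bound survives each of them. The equation `hg` keeps the history general for the
induction. -/
theorem PairSolution.min_le {I g h C : List α}
    {z : α} {k : ℕ} (H : PairSolution I g C k) (hg : g = z :: h) :
    min (workFunction I h C + C.idxOf z)
      (workFunction I h C.reverse + C.reverse.idxOf z + 1) ≤ k := by
  induction H with
  | start => cases hg
  | swap g a b k _ ih =>
    have := ih hg
    simp only [List.reverse_cons, List.reverse_nil, List.nil_append, List.singleton_append] at *
    omega
  | access g C w k H _ =>
    obtain ⟨rfl, rfl⟩ := List.cons.inj hg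
    have := workFunction_le H
    omega

theorem workFunction_cons {x y : α} {I : List α} (hI : I = [x, y] ∨ I = [y, x]) (h : List α)
    (z : α) :
    workFunction I (z :: h) [x, y] =
      min (workFunction I h [x, y] + [x, y].idxOf z)
        (workFunction I h [y, x] + [y, x].idxOf z + 1) := by
  apply le_antisymm
  · apply le_min
    · exact workFunction_le (.access _ _ _ _ (pairSolution_workFunction hI h))
    · exact workFunction_le
        (.swap _ _ _ _ (.access _ _ _ _ (pairSolution_workFunction hI.symm h)))
  · exact PairSolution.min_le (pairSolution_workFunction hI (z :: h)) rfl

/-- The access is free in configuration xy, and W(xy) ≤ W(yx) + 1 makes a detour through yx useless.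
-/
theorem workFunction_cons_left {x y : α} (hxy : x ≠ y) {I : List α}
    (hI : I = [x, y] ∨ I = [y, x]) (h : List α) :
    workFunction I (x :: h) [x, y] = workFunction I h [x, y] := by
  rw [workFunction_cons hI]
  have := workFunction_swap_le hI h
  simp [hxy.symm]
  omega

theorem workFunction_cons_right {x y : α} (hxy : x ≠ y) {I : List α}
    (hI : I = [x, y] ∨ I = [y, x]) (h : List α) :
    workFunction I (y :: h) [x, y] =
      min (workFunction I h [x, y]) (workFunction I h [y, x]) + 1 := by
  rw [workFunction_cons hI]
  simp [hxy]

/-! ## Modes and flavors -/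

/-- The mode of a pair seen in the opposite list order. -/
def Mode.flip : Mode → Mode
  | .a => .c
  | .b => .b
  | .c => .a

/-- The effect on the mode of a request to the first item of the pair. -/
def Mode.hitFirst : Mode → Mode
  | .a => .a
  | .b => .a
  | .c => .b

/-- The effect on the mode of a request to the second item of the pair. -/
def Mode.hitSecond : Mode → Mode
  | .a => .b
  | .b => .c
  | .c => .c

/-- The flavor of a pair in terms of the positions of its first item, of the target of
its second item, and of the target of its first item. -/
def flavorAt (p qx qy : ℕ) : Flavor :=
  if p < qx then .d else if qy < qx then .o else if qy = qx then .e else .n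

/-- The combinations of mode and flavor that may occur. -/
def Allowed (m : Mode) (f : Flavor) : Prop :=
  (m = .a → f ≠ .n) ∧ (m = .c → f = .e ∨ f = .n)

namespace State

/-- The structural invariants of the states of FPM. -/
structure Regular (s : State α) : Prop where
  nodup : s.list.Nodup
  target_mem : ∀ x ∈ s.list, s.target x ∈ s.list
  target_le : ∀ x ∈ s.list, s.pos (s.target x) ≤ s.pos x
  init_eq : ∀ x ∈ s.list, ∀ y ∈ s.list, x ≠ y → s.init x y = [x, y] ∨ s.init x y = [y, x]
  init_symm : ∀ x ∈ s.list, ∀ y ∈ s.list, x ≠ y → s.init x y = s.init y x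
  hist_symm : ∀ x ∈ s.list, ∀ y ∈ s.list, x ≠ y → s.hist x y = s.hist y x

/-- Every active pair is in one of the states that may occur. -/
def AllowedStates (s : State α) : Prop :=
  ∀ x ∈ s.list, ∀ y ∈ s.list, s.pos y < s.pos x → Allowed (s.mode y x) (s.flavor y x)

variable {s : State α} {x y z : α}

theorem pos_inj (hx : x ∈ s.list) : s.pos x = s.pos y ↔ x = y :=
  List.idxOf_inj hx

theorem pos_ne (hz : z ∈ s.list) (hx : x ≠ z) : s.pos x ≠ s.pos z := fun h =>
  hx ((pos_inj hz).1 h.symm).symm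

theorem pos_lt_length (hx : x ∈ s.list) : s.pos x < s.list.length :=
  List.idxOf_lt_length_of_mem hx

theorem ne_of_pos_lt (h : s.pos x < s.pos y) : x ≠ y := by
  rintro rfl
  exact lt_irrefl _ h

theorem Regular.flavor_eq (hs : s.Regular) (hy : y ∈ s.list) :
    s.flavor y x = flavorAt (s.pos y) (s.pos (s.target x)) (s.pos (s.target y)) := by
  simp only [flavor, flavorAt, pos_inj (hs.target_mem y hy)]

theorem Regular.work_symm (hs : s.Regular) (hx : x ∈ s.list) (hy : y ∈ s.list) (hxy : x ≠ y) :
    s.work y x = workFunction (s.init x y) (s.hist x y) [y, x] := by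
  rw [work, hs.init_symm x hx y hy hxy, hs.hist_symm x hx y hy hxy]

theorem Regular.work_le (hs : s.Regular) (hx : x ∈ s.list) (hy : y ∈ s.list) (hxy : x ≠ y) :
    s.work x y ≤ s.work y x + 1 := by
  rw [hs.work_symm hx hy hxy]
  exact workFunction_swap_le (hs.init_eq x hx y hy hxy) _

/-- The two work function values differ by at most 1, so the fallback case `.c` really means a
difference of 1, the mirror image of `.a`. -/
theorem Regular.mode_flip (hs : s.Regular) (hx : x ∈ s.list) (hy : y ∈ s.list) (hxy : x ≠ y) :
    s.mode x y = (s.mode y x).flip := by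
  have h1 := hs.work_le hx hy hxy
  have h2 := hs.work_le hy hx hxy.symm
  simp only [mode]
  split_ifs <;> first | rfl | omega

theorem potential_of_mem (hx : x ∈ s.list) (hy : y ∈ s.list) :
    s.potential x y = if s.pos y < s.pos x then stateValue (s.mode y x) (s.flavor y x)
      else stateValue (s.mode x y) (s.flavor x y) :=
  if_pos ⟨hx, hy⟩

theorem potential_of_lt (hx : x ∈ s.list) (hy : y ∈ s.list) (h : s.pos y < s.pos x) :
    s.potential x y = stateValue (s.mode y x) (s.flavor y x) := by
  simp [potential, hx, hy, h]

theorem potential_of_lt' (hx : x ∈ s.list) (hy : y ∈ s.list) (h : s.pos y < s.pos x) :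
    s.potential y x = stateValue (s.mode y x) (s.flavor y x) := by
  simp [potential, hx, hy, h.not_gt]

theorem potential_symm (hx : x ∈ s.list) (hy : y ∈ s.list) (hxy : x ≠ y) :
    s.potential x y = s.potential y x := by
  rcases lt_or_gt_of_ne ((pos_inj hx).not.2 hxy) with h | h
  · rw [potential_of_lt hy hx h, potential_of_lt' hy hx h]
  · rw [potential_of_lt hx hy h, potential_of_lt' hx hy h]

/-! ## The effect of an access -/

theorem Regular.dest_le (hs : s.Regular) (hz : z ∈ s.list) (full : Bool) :
    s.dest z full ≤ s.pos z := by
  cases full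
  · exact hs.target_le z hz
  · exact Nat.zero_le _

theorem Regular.movedList_perm (hs : s.Regular) (hz : z ∈ s.list) (full : Bool) :
    (s.movedList z full).Perm s.list :=
  perm_erase_insertIdx hz (hs.dest_le hz full)

theorem Regular.mem_afterAccess (hs : s.Regular) (hz : z ∈ s.list) (full : Bool) :
    x ∈ (s.afterAccess z full).list ↔ x ∈ s.list :=
  (hs.movedList_perm hz full).mem_iff

theorem Regular.pos_afterAccess_self (hs : s.Regular) (hz : z ∈ s.list) (full : Bool) :
    (s.afterAccess z full).pos z = s.dest z full :=
  idxOf_erase_insertIdx_self hs.nodup hz (hs.dest_le hz full)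

theorem Regular.pos_afterAccess (hs : s.Regular) (hz : z ∈ s.list) (full : Bool) (hx : x ≠ z) :
    (s.afterAccess z full).pos x =
      s.pos x + if s.dest z full ≤ s.pos x ∧ s.pos x < s.pos z then 1 else 0 :=
  idxOf_erase_insertIdx_of_ne hs.nodup hz (hs.dest_le hz full) hx

theorem Regular.movedList_ne_nil (hs : s.Regular) (hz : z ∈ s.list) (full : Bool) :
    s.movedList z full ≠ [] :=
  List.ne_nil_of_mem ((hs.movedList_perm hz full).mem_iff.2 hz)

theorem Regular.pos_target_afterAccess_self (hs : s.Regular) (hz : z ∈ s.list) (full : Bool) :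
    (s.afterAccess z full).pos ((s.afterAccess z full).target z) = 0 := by
  obtain ⟨w, l, h⟩ := List.exists_cons_of_ne_nil (hs.movedList_ne_nil hz full)
  simp [pos, afterAccess, h]

/-- An item that targets z and is not z lies behind z. Hence z is not last and the default of `getD`
is never used. -/
theorem Regular.successor (hs : s.Regular) (hx : x ∈ s.list) (hxz : x ≠ z)
    (h : s.target x = z) :
    s.list.getD (s.pos z + 1) z ∈ s.list ∧
      s.pos (s.list.getD (s.pos z + 1) z) = s.pos z + 1 := by
  have h1 := hs.target_le x hx
  rw [h] at h1
  have h2 : s.pos x ≠ s.pos z := (pos_inj hx).not.2 hxz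
  have h3 := pos_lt_length hx
  have h4 : s.pos z + 1 < s.list.length := by omega
  rw [List.getD_eq_getElem _ _ h4]
  exact ⟨List.getElem_mem _, hs.nodup.idxOf_getElem _ _⟩

theorem Regular.target_afterAccess_ne (hs : s.Regular) (hx : x ∈ s.list) (hxz : x ≠ z)
    (full : Bool) : (s.afterAccess z full).target x ≠ z := by
  simp only [afterAccess, hxz, if_false]
  split_ifs with h
  · intro h'
    have := (hs.successor hx hxz h).2
    rw [h'] at this
    omega
  · exact h

theorem Regular.pos_target_afterAccess (hs : s.Regular) (hz : z ∈ s.list) (full : Bool)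
    (hx : x ∈ s.list) (hxz : x ≠ z) :
    (s.afterAccess z full).pos ((s.afterAccess z full).target x) =
      if s.pos (s.target x) = s.pos z then s.pos z + 1
      else s.pos (s.target x) +
        if s.dest z full ≤ s.pos (s.target x) ∧ s.pos (s.target x) < s.pos z then 1 else 0 := by
  rw [hs.pos_afterAccess hz full (hs.target_afterAccess_ne hx hxz full)]
  simp only [afterAccess, hxz, if_false, pos_inj (hs.target_mem x hx)]
  split_ifs with h <;> first | rfl | (have := (hs.successor hx hxz h).2; omega)

theorem Regular.afterAccess (hs : s.Regular) (hz : z ∈ s.list) (full : Bool) :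
    (s.afterAccess z full).Regular where
  nodup := (hs.movedList_perm hz full).nodup_iff.2 hs.nodup
  target_mem x hx := by
    rw [hs.mem_afterAccess hz] at hx ⊢
    simp only [State.afterAccess]
    split_ifs with h1 h2
    · obtain ⟨w, l, h⟩ := List.exists_cons_of_ne_nil (hs.movedList_ne_nil hz full)
      rw [← (hs.movedList_perm hz full).mem_iff, h]
      simp
    · exact (hs.successor hx h1 h2).1
    · exact hs.target_mem x hx
  target_le x hx := by
    rw [hs.mem_afterAccess hz] at hx
    by_cases hxz : x = z
    · rw [hxz, hs.pos_target_afterAccess_self hz]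
      exact Nat.zero_le _
    · rw [hs.pos_target_afterAccess hz full hx hxz, hs.pos_afterAccess hz full hxz]
      have h1 := hs.target_le x hx
      have h2 : s.pos x ≠ s.pos z := (pos_inj hx).not.2 hxz
      split_ifs <;> omega
  init_eq x hx y hy := by
    rw [hs.mem_afterAccess hz] at hx hy
    exact hs.init_eq x hx y hy
  init_symm x hx y hy := by
    rw [hs.mem_afterAccess hz] at hx hy
    exact hs.init_symm x hx y hy
  hist_symm x hx y hy hxy := by
    rw [hs.mem_afterAccess hz] at hx hy
    simp only [State.afterAccess, hs.hist_symm x hx y hy hxy, and_comm, and_left_comm, or_comm]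

/-! ### Modes after an access. -/

theorem mode_afterAccess_of_ne (full : Bool) (hx : x ≠ z) (hy : y ≠ z) :
    (s.afterAccess z full).mode y x = s.mode y x := by
  have h1 : (s.afterAccess z full).work y x = s.work y x := by simp [work, afterAccess, hx, hy]
  have h2 : (s.afterAccess z full).work x y = s.work x y := by simp [work, afterAccess, hx, hy]
  rw [mode, mode, h1, h2]

theorem Regular.work_afterAccess_left (hs : s.Regular) (hz : z ∈ s.list) (hy : y ∈ s.list)
    (h : y ≠ z) (full : Bool) : (s.afterAccess z full).work z y = s.work z y := by
  have : (s.afterAccess z full).hist z y = z :: s.hist z y := by simp [State.afterAccess, hz, hy]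
  rw [work, this]
  exact workFunction_cons_left h.symm (hs.init_eq z hz y hy h.symm) _

theorem Regular.work_afterAccess_right (hs : s.Regular) (hz : z ∈ s.list) (hy : y ∈ s.list)
    (h : y ≠ z) (full : Bool) :
    (s.afterAccess z full).work y z = min (s.work y z) (s.work z y) + 1 := by
  have : (s.afterAccess z full).hist y z = z :: s.hist y z := by simp [State.afterAccess, hz, hy]
  rw [work, this, hs.work_symm hy hz h]
  exact workFunction_cons_right h (hs.init_eq y hy z hz h) _

theorem Regular.mode_afterAccess_left (hs : s.Regular) (hz : z ∈ s.list) (hy : y ∈ s.list)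
    (h : y ≠ z) (full : Bool) : (s.afterAccess z full).mode z y = (s.mode z y).hitFirst := by
  have h1 := hs.work_le hz hy h.symm
  have h2 := hs.work_le hy hz h
  simp only [mode, hs.work_afterAccess_left hz hy h, hs.work_afterAccess_right hz hy h]
  split_ifs <;> first | rfl | omega

theorem Regular.mode_afterAccess_right (hs : s.Regular) (hz : z ∈ s.list) (hy : y ∈ s.list)
    (h : y ≠ z) (full : Bool) : (s.afterAccess z full).mode y z = (s.mode y z).hitSecond := by
  have h1 := hs.work_le hz hy h.symm
  have h2 := hs.work_le hy hz h
  simp only [mode, hs.work_afterAccess_left hz hy h, hs.work_afterAccess_right hz hy h]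
  split_ifs <;> first | rfl | omega

/-! ### Relative order and flavors after an access. -/

theorem Regular.pos_afterAccess_lt_iff (hs : s.Regular) (hz : z ∈ s.list) (full : Bool)
    (hx : x ≠ z) (hy : y ≠ z) :
    (s.afterAccess z full).pos y < (s.afterAccess z full).pos x ↔ s.pos y < s.pos x := by
  rw [hs.pos_afterAccess hz full hx, hs.pos_afterAccess hz full hy]
  have h1 := pos_ne hz hx
  have h2 := pos_ne hz hy
  have h3 := hs.dest_le hz full
  split_ifs <;> omega

theorem Regular.pos_afterAccess_self_lt_iff (hs : s.Regular) (hz : z ∈ s.list) (full : Bool)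
    (hy : y ≠ z) :
    (s.afterAccess z full).pos z < (s.afterAccess z full).pos y ↔ s.dest z full ≤ s.pos y := by
  rw [hs.pos_afterAccess hz full hy, hs.pos_afterAccess_self hz full]
  have h2 := pos_ne hz hy
  have := hs.dest_le hz full
  split_ifs <;> omega

theorem Regular.pos_afterAccess_lt_self_iff (hs : s.Regular) (hz : z ∈ s.list) (full : Bool)
    (hy : y ≠ z) :
    (s.afterAccess z full).pos y < (s.afterAccess z full).pos z ↔ s.pos y < s.dest z full := by
  rw [hs.pos_afterAccess hz full hy, hs.pos_afterAccess_self hz full]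
  have h2 := pos_ne hz hy
  have := hs.dest_le hz full
  split_ifs <;> omega

/-- Only targets equal to z change, and only to the next item. Thus no order comparison is reversed;
at most two different targets merge. -/
theorem Regular.flavor_afterAccess_of_ne (hs : s.Regular) (hz : z ∈ s.list) (full : Bool)
    (hx : x ∈ s.list) (hy : y ∈ s.list) (hxz : x ≠ z) (hyz : y ≠ z) :
    (s.afterAccess z full).flavor y x = s.flavor y x ∨
      (s.afterAccess z full).flavor y x = .e ∧ (s.flavor y x = .o ∨ s.flavor y x = .n) := by
  rw [hs.flavor_eq hy, (hs.afterAccess hz full).flavor_eq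
    ((hs.mem_afterAccess hz full).2 hy),
    hs.pos_target_afterAccess hz full hx hxz, hs.pos_target_afterAccess hz full hy hyz,
    hs.pos_afterAccess hz full hyz]
  have h2 : s.pos y ≠ s.pos z := (pos_inj hy).not.2 hyz
  have h3 := hs.dest_le hz full
  have h4 := hs.target_le y hy
  simp only [flavorAt]
  generalize s.pos (s.target x) = qx at *
  generalize s.pos (s.target y) = qy at *
  generalize s.pos y = p at *
  generalize s.pos z = pz at *
  generalize s.dest z full = d at *
  by_cases e1 : qx = pz <;> by_cases e2 : qy = pz <;> simp only [e1, e2, if_true, if_false] <;>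
    split_ifs <;> first | simp; done | omega

theorem Regular.flavor_afterAccess_first (hs : s.Regular) (hz : z ∈ s.list) (full : Bool) :
    (s.afterAccess z full).flavor z y = flavorAt (s.dest z full)
      ((s.afterAccess z full).pos ((s.afterAccess z full).target y)) 0 := by
  rw [(hs.afterAccess hz full).flavor_eq
    ((hs.mem_afterAccess hz full).2 hz),
    hs.pos_target_afterAccess_self hz full, hs.pos_afterAccess_self hz full]

/-- The target of z is now the front item, so it cannot lie behind y or behind the target of y. -/
theorem Regular.flavor_afterAccess_second (hs : s.Regular) (hz : z ∈ s.list) (full : Bool)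
    (hy : y ∈ s.list) :
    (s.afterAccess z full).flavor y z = .e ∨ (s.afterAccess z full).flavor y z = .n := by
  rw [(hs.afterAccess hz full).flavor_eq
    ((hs.mem_afterAccess hz full).2 hy),
    hs.pos_target_afterAccess_self hz full]
  simp only [flavorAt]
  split_ifs <;> simp_all

theorem Regular.flavor_afterAccess_first_ne (hs : s.Regular) (hz : z ∈ s.list) (full : Bool) : (s.afterAccess z full).flavor z y ≠ .n := by
  rw [hs.flavor_afterAccess_first hz full]
  simp only [flavorAt]
  split_ifs <;> first | simp; done | omega

theorem Regular.flavor_afterAccess_of_lt (hs : s.Regular) (hz : z ∈ s.list) (full : Bool)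
    (hy : y ∈ s.list) (h : s.pos z < s.pos y) (hf : s.flavor z y = .d) :
    (s.afterAccess z full).flavor z y = .d := by
  have hyz := (ne_of_pos_lt h).symm
  rw [hs.flavor_afterAccess_first hz full, hs.pos_target_afterAccess hz full hy hyz]
  rw [hs.flavor_eq hz] at hf
  have h3 := hs.dest_le hz full
  simp only [flavorAt] at hf ⊢
  split_ifs at hf ⊢ <;> first | rfl | omega

theorem Regular.flavor_full (hs : s.Regular) (hz : z ∈ s.list)
    (hy : y ∈ s.list) (h : s.pos y < s.pos z) :
    (s.afterAccess z true).flavor z y = .d := by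
  have hyz := ne_of_pos_lt h
  rw [hs.flavor_afterAccess_first hz true, hs.pos_target_afterAccess hz true hy hyz]
  have h4 := hs.target_le y hy
  simp only [flavorAt, dest, if_true]
  split_ifs <;> first | rfl | omega

theorem Regular.flavor_eq_d_iff (hs : s.Regular) (hy : y ∈ s.list) :
    s.flavor y z = .d ↔ s.pos y < s.dest z false := by
  rw [hs.flavor_eq hy]
  simp only [flavorAt, dest]
  split_ifs <;> simp_all

/-- The item z lands right before its old target. For flavors e and n the target of y is not before
that place, so z ends up before it. For flavor o the target of y stays before z, and its comparison
with the front item, the new target of z, decides between o and e. -/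
theorem Regular.flavor_partial (hs : s.Regular) (hz : z ∈ s.list)
    (hy : y ∈ s.list) (h : s.pos y < s.pos z) (hf : s.flavor y z ≠ .d) :
    ((s.flavor y z = .e ∨ s.flavor y z = .n) ∧ (s.afterAccess z false).flavor z y = .d) ∨
    (s.flavor y z = .o ∧ ((s.afterAccess z false).flavor z y = .o ∨
      (s.afterAccess z false).flavor z y = .e)) := by
  have hyz := ne_of_pos_lt h
  rw [hs.flavor_eq hy] at *
  rw [hs.flavor_afterAccess_first hz false, hs.pos_target_afterAccess hz false hy hyz]
  have h4 := hs.target_le y hy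
  simp only [flavorAt, dest, Bool.false_eq_true, if_false] at hf ⊢
  clear hs
  generalize s.pos (s.target z) = qz at *
  generalize s.pos (s.target y) = qy at *
  generalize s.pos y = p at *
  generalize s.pos z = pz at *
  have h5 : ¬ p < qz := fun h => hf (if_pos h)
  have h6 : qy ≠ pz := by omega
  simp only [h5, h6, if_false]
  split_ifs <;> first | simp; done | omega

/-- If z ends up second, the mode is not α and the flavor is e or n; if first, the mode is not γ and
the flavor is not n. In other pairs a new flavor can only be e, which suits every mode. -/
theorem Regular.allowedStates_afterAccess (hs : s.Regular) (hA : s.AllowedStates)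
    (hz : z ∈ s.list) (full : Bool) : (s.afterAccess z full).AllowedStates := by
  intro x hx y hy hlt
  rw [hs.mem_afterAccess hz] at hx hy
  by_cases hxz : x = z
  · subst hxz
    have hyx := ne_of_pos_lt hlt
    rw [hs.mode_afterAccess_right hz hy hyx]
    have := hs.flavor_afterAccess_second hz full hy
    refine ⟨?_, fun _ => this⟩
    cases s.mode y x <;> simp [Mode.hitSecond]
  by_cases hyz : y = z
  · subst hyz
    rw [hs.mode_afterAccess_left hz hx hxz]
    have := hs.flavor_afterAccess_first_ne (y := x) hz full
    refine ⟨fun _ => this, ?_⟩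
    cases s.mode y x <;> simp [Mode.hitFirst]
  · rw [hs.pos_afterAccess_lt_iff hz full hxz hyz] at hlt
    rw [mode_afterAccess_of_ne full hxz hyz]
    have h1 := hA x hx y hy hlt
    rcases hs.flavor_afterAccess_of_ne hz full hx hy hxz hyz with h | ⟨h, -⟩
    · rwa [h]
    · rw [h]
      exact ⟨by simp, by simp⟩

/-! ## The effect of insertions and removals -/

theorem pos_insertItem (hx : x ∈ s.list) : (s.insertItem z).pos x = s.pos x :=
  List.idxOf_append_of_mem hx

theorem pos_insertItem_self (hz : z ∉ s.list) : (s.insertItem z).pos z = s.list.length := by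
  simp [pos, insertItem, List.idxOf_append, hz]

theorem mem_insertItem : x ∈ (s.insertItem z).list ↔ x ∈ s.list ∨ x = z := by
  simp [insertItem]

theorem Regular.insertItem (hs : s.Regular) (hz : z ∉ s.list) : (s.insertItem z).Regular where
  nodup := by
    have := hs.nodup
    simp only [State.insertItem]
    grind
  target_mem x hx := by
    rw [mem_insertItem] at hx ⊢
    simp only [State.insertItem]
    have := hs.target_mem x
    split_ifs <;> tauto
  target_le x hx := by
    by_cases hxz : x = z
    · simp [State.insertItem, hxz]
    · have hx' : x ∈ s.list := (mem_insertItem.1 hx).resolve_right hxz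
      have : (s.insertItem z).target x = s.target x := by simp [State.insertItem, hxz]
      rw [this, pos_insertItem (hs.target_mem x hx'), pos_insertItem hx']
      exact hs.target_le x hx'
  init_eq x hx y hy hxy := by
    rw [mem_insertItem] at hx hy
    have := hs.init_eq x
    simp only [State.insertItem]
    split_ifs <;> simp_all
  init_symm x hx y hy hxy := by
    rw [mem_insertItem] at hx hy
    have := hs.init_symm x
    simp only [State.insertItem]
    split_ifs <;> simp_all
  hist_symm x hx y hy hxy := by
    rw [mem_insertItem] at hx hy
    have := hs.hist_symm x
    simp only [State.insertItem, or_comm]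
    split_ifs <;> simp_all

theorem mode_insertItem_of_ne (hx : x ≠ z) (hy : y ≠ z) :
    (s.insertItem z).mode y x = s.mode y x := by
  have h1 : (s.insertItem z).work y x = s.work y x := by simp [work, insertItem, hx, hy]
  have h2 : (s.insertItem z).work x y = s.work x y := by simp [work, insertItem, hx, hy]
  rw [mode, mode, h1, h2]

theorem Regular.flavor_insertItem_of_ne (hs : s.Regular) (hx : x ∈ s.list) (hy : y ∈ s.list)
    (hxz : x ≠ z) (hyz : y ≠ z) : (s.insertItem z).flavor y x = s.flavor y x := by
  have h : ∀ w, w ≠ z → (s.insertItem z).target w = s.target w := fun w hw => by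
    simp [State.insertItem, hw]
  simp only [flavor, h x hxz, h y hyz, pos_insertItem hy, pos_insertItem (hs.target_mem x hx),
    pos_insertItem (hs.target_mem y hy)]

theorem mode_eq_a_of_init {x y : α} (hxy : x ≠ y) (h : s.init y x = [y, x])
    (h' : s.init x y = [y, x]) (h1 : s.hist y x = []) (h2 : s.hist x y = []) :
    s.mode y x = .a := by
  simp [mode, work, *, workFunction_nil_self, workFunction_nil_swap hxy.symm]

theorem mode_insertItem_self (hy : y ≠ z) : (s.insertItem z).mode y z = .a := by
  apply mode_eq_a_of_init hy.symm <;> simp [insertItem, hy]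

theorem flavor_insertItem_self (hz : z ∉ s.list) (hy : y ∈ s.list) :
    (s.insertItem z).flavor y z = .d := by
  have h : (s.insertItem z).target z = z := by simp [insertItem]
  have := pos_lt_length hy
  simp [flavor, h, pos_insertItem_self hz, pos_insertItem hy, this]

theorem Regular.allowedStates_insertItem (hs : s.Regular) (hA : s.AllowedStates)
    (hz : z ∉ s.list) : (s.insertItem z).AllowedStates := by
  intro x hx y hy hlt
  rw [mem_insertItem] at hx hy
  have hyz : y ≠ z := by
    rintro rfl
    rcases hx with hx | rfl
    · rw [pos_insertItem_self hz, pos_insertItem hx] at hlt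
      have := pos_lt_length hx
      omega
    · omega
  replace hy := hy.resolve_right hyz
  by_cases hxz : x = z
  · subst hxz
    rw [mode_insertItem_self hyz, flavor_insertItem_self hz hy]
    exact ⟨by simp, by simp⟩
  · replace hx := hx.resolve_right hxz
    rw [pos_insertItem hx, pos_insertItem hy] at hlt
    rw [mode_insertItem_of_ne hxz hyz, hs.flavor_insertItem_of_ne hx hy hxz hyz]
    exact hA x hx y hy hlt

/-- No item other than `z` has `z` as its target. -/
def Untargeted (s : State α) (z : α) : Prop :=
  ∀ x ∈ s.list, x ≠ z → s.target x ≠ z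

theorem Regular.untargeted_afterAccess (hs : s.Regular) (hz : z ∈ s.list) (full : Bool) :
    (s.afterAccess z full).Untargeted z := fun _ hx hxz =>
  hs.target_afterAccess_ne ((hs.mem_afterAccess hz full).1 hx) hxz full

theorem Regular.mem_removeItem (hs : s.Regular) :
    x ∈ (s.removeItem z).list ↔ x ≠ z ∧ x ∈ s.list :=
  hs.nodup.mem_erase_iff

theorem pos_removeItem_lt_iff (hx : x ≠ z) (hy : y ≠ z) :
    (s.removeItem z).pos y < (s.removeItem z).pos x ↔ s.pos y < s.pos x :=
  idxOf_erase_lt_idxOf_erase hy hx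

theorem Regular.removeItem (hs : s.Regular) (hz : s.Untargeted z) : (s.removeItem z).Regular where
  nodup := hs.nodup.erase z
  target_mem x hx := by
    rw [hs.mem_removeItem] at hx ⊢
    exact ⟨hz x hx.2 hx.1, hs.target_mem x hx.2⟩
  target_le x hx := by
    rw [hs.mem_removeItem] at hx
    rw [← not_lt, show (s.removeItem z).target x = s.target x from rfl,
      pos_removeItem_lt_iff (hz x hx.2 hx.1) hx.1, not_lt]
    exact hs.target_le x hx.2
  init_eq x hx y hy :=
    hs.init_eq x (hs.mem_removeItem.1 hx).2 y (hs.mem_removeItem.1 hy).2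
  init_symm x hx y hy :=
    hs.init_symm x (hs.mem_removeItem.1 hx).2 y (hs.mem_removeItem.1 hy).2
  hist_symm x hx y hy :=
    hs.hist_symm x (hs.mem_removeItem.1 hx).2 y (hs.mem_removeItem.1 hy).2

theorem mode_removeItem : (s.removeItem z).mode y x = s.mode y x := rfl

theorem flavor_removeItem (hz : s.Untargeted z) (hx : x ∈ s.list) (hy : y ∈ s.list)
    (hxz : x ≠ z) (hyz : y ≠ z) : (s.removeItem z).flavor y x = s.flavor y x := by
  simp only [flavor, show (s.removeItem z).target = s.target from rfl,
    pos_removeItem_lt_iff (hz x hx hxz) hyz, pos_removeItem_lt_iff (hz x hx hxz) (hz y hy hyz)]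

theorem Regular.allowedStates_removeItem (hs : s.Regular) (hA : s.AllowedStates)
    (hz : s.Untargeted z) : (s.removeItem z).AllowedStates := by
  intro x hx y hy hlt
  rw [hs.mem_removeItem] at hx hy
  rw [pos_removeItem_lt_iff hx.1 hy.1] at hlt
  rw [mode_removeItem, flavor_removeItem hz hx.2 hy.2 hx.1 hy.1]
  exact hA x hx.2 y hy.2 hlt

/-- For a pair that stays active, the mode is untouched and the flavor compares only items different
from z, since no target is z. Otherwise the old value is exactly what is stored. -/
theorem Regular.potential_removeItem (hs : s.Regular) (hz : s.Untargeted z) :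
    (s.removeItem z).potential x y = s.potential x y := by
  by_cases h : x ∈ (s.removeItem z).list ∧ y ∈ (s.removeItem z).list
  · have h' := h
    simp only [hs.mem_removeItem] at h'
    obtain ⟨⟨hxz, hx⟩, hyz, hy⟩ := h'
    rw [potential_of_mem h.1 h.2, potential_of_mem hx hy]
    simp only [pos_removeItem_lt_iff hxz hyz, mode_removeItem,
      flavor_removeItem hz hx hy hxz hyz, flavor_removeItem hz hy hx hyz hxz]
  · rw [potential, if_neg h]
    rfl

theorem Regular.potential_insertItem_of_ne (hs : s.Regular) (hx : x ≠ z) (hy : y ≠ z) :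
    (s.insertItem z).potential x y = s.potential x y := by
  by_cases h : x ∈ s.list ∧ y ∈ s.list
  · obtain ⟨hx', hy'⟩ := h
    rw [potential_of_mem (mem_insertItem.2 (.inl hx')) (mem_insertItem.2 (.inl hy')),
      potential_of_mem hx' hy']
    simp only [pos_insertItem hx', pos_insertItem hy',
      mode_insertItem_of_ne hx hy, mode_insertItem_of_ne hy hx,
      hs.flavor_insertItem_of_ne hx' hy' hx hy, hs.flavor_insertItem_of_ne hy' hx' hy hx]
  · simp only [potential, mem_insertItem, hx, hy, or_false, h, if_false]
    rfl

theorem potential_insertItem_self (hz : z ∉ s.list) (hy : y ∈ s.list) :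
    (s.insertItem z).potential z y = 0 ∧ (s.insertItem z).potential y z = 0 := by
  have hyz : y ≠ z := by rintro rfl; exact hz hy
  have h1 : z ∈ (s.insertItem z).list := mem_insertItem.2 (.inr rfl)
  have h2 : y ∈ (s.insertItem z).list := mem_insertItem.2 (.inl hy)
  have h3 : (s.insertItem z).pos y < (s.insertItem z).pos z := by
    rw [pos_insertItem hy, pos_insertItem_self hz]
    exact pos_lt_length hy
  rw [potential_of_lt h1 h2 h3, potential_of_lt' h1 h2 h3, mode_insertItem_self hyz,
    flavor_insertItem_self hz hy]
  exact ⟨rfl, rfl⟩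

/-! ## The initial state -/

theorem regular_initial {L : List α} (hL : L.Nodup) : (initial L).Regular where
  nodup := hL
  target_mem _ hx := hx
  target_le _ _ := le_rfl
  init_eq x _ y _ _ := by
    simp only [initial]
    split_ifs <;> simp
  init_symm x hx y _ hxy := by
    have : L.idxOf x ≠ L.idxOf y := (List.idxOf_inj hx).not.2 hxy
    simp only [initial]
    split_ifs <;> first | rfl | omega
  hist_symm _ _ _ _ _ := rfl

theorem mode_initial {L : List α} (h : L.idxOf y < L.idxOf x) :
    (initial L).mode y x = .a := by
  have hxy : x ≠ y := by rintro rfl; omega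
  apply mode_eq_a_of_init hxy <;> simp [initial, h, h.le]

theorem flavor_initial {L : List α} (h : L.idxOf y < L.idxOf x) :
    (initial L).flavor y x = .d := by
  simp [flavor, initial, pos, h]

theorem allowedStates_initial {L : List α} : (initial L).AllowedStates := by
  intro x _ y _ h
  change L.idxOf y < L.idxOf x at h
  rw [mode_initial h, flavor_initial h]
  exact ⟨by simp, by simp⟩

end State

/-! ## Numerical estimates -/

/-- The competitive ratio of FPM. -/
noncomputable def ratio : ℝ := (23 + √17) / 8

/-- The amount by which the work function at the first configuration of a pair exceeds its
optimistic value. -/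
noncomputable def Mode.lag : Mode → ℝ
  | .a => 0
  | .b => 1 / 2
  | .c => 1

/-- The growth of the averaged work function caused by a request to the second item. -/
noncomputable def Mode.budget : Mode → ℝ
  | .a => 1 / 2
  | .b => 1 / 2
  | .c => 0

theorem sq_sqrt_seventeen : √17 * √17 = (17 : ℝ) := Real.mul_self_sqrt (by norm_num)

theorem sqrt_seventeen_gt : (4.12 : ℝ) < √17 := Real.lt_sqrt_of_sq_lt (by norm_num)

theorem sqrt_seventeen_lt : √17 < (4.1232 : ℝ) := by
  rw [Real.sqrt_lt' (by norm_num)]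
  norm_num

theorem ratio_nonneg : 0 ≤ ratio := by
  have := sqrt_seventeen_gt
  rw [ratio]
  linarith

theorem one_le_ratio : 1 ≤ ratio := by
  have := sqrt_seventeen_gt
  rw [ratio]
  linarith

theorem stateValue_nonneg (m : Mode) (f : Flavor) : 0 ≤ stateValue m f := by
  have h1 := sqrt_seventeen_gt
  have h2 := sqrt_seventeen_lt
  cases m <;> cases f <;> simp only [stateValue] <;> linarith

theorem Mode.lag_nonneg (m : Mode) : 0 ≤ m.lag := by
  cases m <;> norm_num [Mode.lag]

theorem Mode.lag_le_one (m : Mode) : m.lag ≤ 1 := by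
  cases m <;> norm_num [Mode.lag]

/-- For y before x, the lag is W(yx) minus the average of W(xy) and W(yx), plus 1/2. A request to x
raises W(yx) by at most 1 and the average by the budget. -/
theorem Mode.lag_hitSecond_le (m : Mode) : m.hitSecond.lag + m.budget ≤ m.lag + 1 := by
  cases m <;> norm_num [Mode.lag, Mode.hitSecond, Mode.budget]

theorem Mode.lag_hitFirst_le (m : Mode) : m.flip.hitFirst.lag + m.budget ≤ m.flip.lag := by
  cases m <;> norm_num [Mode.lag, Mode.hitFirst, Mode.flip, Mode.budget]

/-- The critical case is mode β with flavor e or n turning into α^e or α^o: there β^e + R/2 = 2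
exactly. Excluding γ^d and γ^o matters because their value is only a default. -/
theorem stateValue_hitFirst_le {m : Mode} {f f' : Flavor} (h : Allowed m f)
    (hf : f = .d → f' = .d) :
    stateValue m.hitFirst f' ≤ stateValue m f + ratio * m.flip.budget := by
  have h1 := sqrt_seventeen_gt
  have h2 := sqrt_seventeen_lt
  cases m <;> cases f <;> cases f' <;> simp [Allowed] at h hf <;>
    simp only [stateValue, Mode.hitFirst, Mode.flip, Mode.budget, ratio] <;> linarith

/-- The weight of the full move in the convex combination that bounds the better move. -/
noncomputable def fullWeight : ℝ := (5 - √17) / 4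

theorem fullWeight_nonneg : 0 ≤ fullWeight := by
  have := sqrt_seventeen_lt
  rw [fullWeight]
  linarith

theorem fullWeight_le_one : fullWeight ≤ 1 := by
  have := sqrt_seventeen_gt
  rw [fullWeight]
  linarith

/-- The full move passes y (cost 2), the partial move does not (cost 1). Equality holds in both α^d
and β^d; together with the tight cases below, this explains the constants. -/
theorem average_le_of_disjoint {m : Mode} {f' : Flavor} (h : Allowed m .d)
    (hf : f' = .e ∨ f' = .n) :
    fullWeight * (2 + (stateValue m.flip.hitFirst .d - stateValue m .d)) +
      (1 - fullWeight) * (1 + (stateValue m.hitSecond f' - stateValue m .d)) ≤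
      ratio * m.budget := by
  -- The weight times a state value is quadratic in √17; this identity makes the inequality linear.
  have h0 := sq_sqrt_seventeen
  have h1 := sqrt_seventeen_gt
  have h2 := sqrt_seventeen_lt
  rcases hf with rfl | rfl <;> cases m <;> simp [Allowed] at h <;>
    simp only [stateValue, Mode.hitFirst, Mode.hitSecond, Mode.flip, Mode.budget, ratio,
      fullWeight] <;> linarith

/-- Both moves pass y. Equality holds for α^o if the partial move leaves flavor o, for β^o, and for
β and γ with flavor e or n. -/
theorem average_le_of_not_disjoint {m : Mode} {f f' : Flavor} (h : Allowed m f)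
    (hf : (f = .e ∨ f = .n) ∧ f' = .d ∨ f = .o ∧ (f' = .o ∨ f' = .e)) :
    fullWeight * (2 + (stateValue m.flip.hitFirst .d - stateValue m f)) +
      (1 - fullWeight) * (2 + (stateValue m.flip.hitFirst f' - stateValue m f)) ≤
      ratio * m.budget := by
  have h0 := sq_sqrt_seventeen
  have h1 := sqrt_seventeen_gt
  have h2 := sqrt_seventeen_lt
  rcases hf with ⟨rfl | rfl, rfl⟩ | ⟨rfl, rfl | rfl⟩ <;> cases m <;> simp [Allowed] at h <;>
    simp only [stateValue, Mode.hitFirst, Mode.flip, Mode.budget, ratio,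
      fullWeight] <;> linarith

/-! ## The total potential -/

theorem sum_offDiag_insert {S : Finset α} {z : α} (hz : z ∉ S) (f : α → α → ℝ)
    (hf : ∀ y ∈ S, f y z = f z y) :
    ∑ q ∈ (insert z S).offDiag, f q.1 q.2 = ∑ q ∈ S.offDiag, f q.1 q.2 + 2 * ∑ y ∈ S, f z y := by
  rw [Finset.offDiag_insert hz, Finset.sum_union, Finset.sum_union, Finset.sum_product,
    Finset.sum_product_right, Finset.sum_singleton, Finset.sum_singleton, Finset.sum_congr rfl hf]
  · ring
  · rw [Finset.disjoint_left]
    rintro ⟨u, v⟩ h1 h2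
    simp only [Finset.mem_offDiag, Finset.mem_product, Finset.mem_singleton] at h1 h2
    exact hz (h2.1 ▸ h1.1)
  · rw [Finset.disjoint_left]
    rintro ⟨u, v⟩ h1 h2
    simp only [Finset.mem_offDiag, Finset.mem_union, Finset.mem_product,
      Finset.mem_singleton] at h1 h2
    rcases h1 with h1 | h1
    · exact hz (h2.2 ▸ h1.2.1)
    · exact hz (h2.2 ▸ h1.2)

namespace State

variable {s : State α} {L : List α} {x y z : α}

/-- The amount by which the work function of the pair `{x, y}`, at the configuration of the
list `L`, exceeds its optimistic value. -/
noncomputable def excess (s : State α) (L : List α) (x y : α) : ℝ :=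
  if L.idxOf y < L.idxOf x then (s.mode y x).lag else (s.mode x y).lag

/-- The potential of a pair, relative to a solution with the list `L`. -/
noncomputable def pairPotential (s : State α) (L : List α) (x y : α) : ℝ :=
  s.potential x y + ratio * s.excess L x y

/-- The sum of the potentials of the active pairs, relative to a solution with the list `L`. -/
noncomputable def totalPotential (s : State α) (L : List α) : ℝ :=
  1 / 2 * ∑ q ∈ s.list.toFinset.offDiag, s.pairPotential L q.1 q.2

theorem excess_nonneg : 0 ≤ s.excess L x y := by
  rw [excess]
  split_ifs <;> exact Mode.lag_nonneg _

theorem excess_le_one : s.excess L x y ≤ 1 := by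
  rw [excess]
  split_ifs <;> exact Mode.lag_le_one _

theorem excess_symm (hx : x ∈ L) (hxy : x ≠ y) : s.excess L x y = s.excess L y x := by
  have : L.idxOf x ≠ L.idxOf y := (List.idxOf_inj hx).not.2 hxy
  simp only [excess]
  split_ifs <;> first | rfl | omega

theorem potential_nonneg (hx : x ∈ s.list) (hy : y ∈ s.list) : 0 ≤ s.potential x y := by
  rw [potential_of_mem hx hy]
  split_ifs <;> exact stateValue_nonneg _ _

theorem pairPotential_nonneg (hx : x ∈ s.list) (hy : y ∈ s.list) :
    0 ≤ s.pairPotential L x y :=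
  add_nonneg (potential_nonneg hx hy) (mul_nonneg ratio_nonneg excess_nonneg)

theorem pairPotential_symm (hx : x ∈ s.list) (hy : y ∈ s.list) (hL : L.Perm s.list)
    (hxy : x ≠ y) : s.pairPotential L x y = s.pairPotential L y x := by
  rw [pairPotential, pairPotential, potential_symm hx hy hxy, excess_symm (hL.mem_iff.2 hx) hxy]

theorem totalPotential_nonneg : 0 ≤ s.totalPotential L := by
  refine mul_nonneg (by norm_num) (Finset.sum_nonneg fun q hq => ?_)
  simp only [Finset.mem_offDiag, List.mem_toFinset] at hq
  exact pairPotential_nonneg hq.1 hq.2.1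

theorem totalPotential_eq (hz : z ∈ s.list) (hL : L.Perm s.list) :
    s.totalPotential L =
      1 / 2 * ∑ q ∈ (s.list.toFinset.erase z).offDiag, s.pairPotential L q.1 q.2 +
        ∑ y ∈ s.list.toFinset.erase z, s.pairPotential L z y := by
  rw [totalPotential]
  conv_lhs => rw [← Finset.insert_erase (List.mem_toFinset.2 hz)]
  rw [sum_offDiag_insert (Finset.notMem_erase z _)]
  · ring
  · intro y hy
    simp only [Finset.mem_erase, List.mem_toFinset] at hy
    exact pairPotential_symm hy.2 hz hL hy.1

theorem totalPotential_initial (L : List α) : (initial L).totalPotential L = 0 := by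
  rw [totalPotential, Finset.sum_eq_zero, mul_zero]
  rintro ⟨x, y⟩ hq
  simp only [Finset.mem_offDiag, List.mem_toFinset] at hq
  obtain ⟨hx, hy, hxy⟩ := hq
  have key : ∀ u v, u ∈ L → v ∈ L → L.idxOf v < L.idxOf u →
      (initial L).pairPotential L u v = 0 := by
    intro u v hu hv h
    rw [pairPotential, potential_of_lt (s := initial L) hu hv h, excess, if_pos h, mode_initial h,
      flavor_initial h]
    simp [stateValue, Mode.lag]
  change x ∈ L at hx
  rcases lt_or_gt_of_ne ((List.idxOf_inj (y := y) hx).not.2 hxy) with h | h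
  · change (initial L).pairPotential L x y = 0
    rw [pairPotential_symm (s := initial L) (L := L) hx hy (List.Perm.refl L) hxy]
    exact key y x hy hx h
  · exact key x y hx hy h

/-! ## The amortized cost of an access -/

/-- Modes and excess are unchanged, and a flavor can only turn from o or n into e. This does not
raise the value in any allowed state; α^n, whose default 0 is below α^e, is excluded. -/
theorem pairPotential_afterAccess_le (hs : s.Regular) (hA : s.AllowedStates) (hz : z ∈ s.list)
    (full : Bool) (hx : x ∈ s.list) (hy : y ∈ s.list) (hxz : x ≠ z) (hyz : y ≠ z)
    (hL : L.Perm s.list) (hxy : x ≠ y) :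
    (s.afterAccess z full).pairPotential L x y ≤ s.pairPotential L x y := by
  have key : ∀ u v, u ∈ s.list → v ∈ s.list → u ≠ z → v ≠ z → s.pos v < s.pos u →
      (s.afterAccess z full).pairPotential L u v ≤ s.pairPotential L u v := by
    intro u v hu hv huz hvz h
    have hA' := hA u hu v hv h
    have h1 := sqrt_seventeen_gt
    rw [pairPotential, pairPotential, excess, mode_afterAccess_of_ne full huz hvz,
      mode_afterAccess_of_ne full hvz huz, ← excess, potential_of_lt hu hv h,
      potential_of_lt ((hs.mem_afterAccess hz full).2 hu) ((hs.mem_afterAccess hz full).2 hv)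
        ((hs.pos_afterAccess_lt_iff hz full huz hvz).2 h), mode_afterAccess_of_ne full huz hvz]
    gcongr
    rcases hs.flavor_afterAccess_of_ne hz full hu hv huz hvz with h | ⟨h, h' | h'⟩
    · rw [h]
    all_goals
      rw [h, h']
      rw [h'] at hA'
      cases hm : s.mode v u <;> simp [hm, Allowed] at hA' <;> simp only [stateValue] <;> linarith
  rcases lt_or_gt_of_ne ((pos_inj hx).not.2 hxy) with h | h
  · rw [pairPotential_symm hx hy hL hxy, pairPotential_symm ((hs.mem_afterAccess hz full).2 hx)
      ((hs.mem_afterAccess hz full).2 hy) (hL.trans (hs.movedList_perm hz full).symm) hxy]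
    exact key y x hy hx hyz hxz h
  · exact key x y hx hy hxz hyz h

/-- The cost that a solution with list `L` pays for `y` when `z` is accessed. -/
noncomputable def payment (L : List α) (z y : α) : ℝ :=
  if L.idxOf y < L.idxOf z then 1 else 0

theorem excess_afterAccess_le (hs : s.Regular) (hz : z ∈ s.list) (full : Bool)
    (hy : y ∈ s.list) (hyz : y ≠ z) (L : List α) :
    (s.afterAccess z full).excess L z y + (s.mode y z).budget ≤
      s.excess L z y + payment L z y := by
  rw [excess, excess, payment, hs.mode_afterAccess_left hz hy hyz,
    hs.mode_afterAccess_right hz hy hyz, hs.mode_flip hz hy hyz.symm]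
  split_ifs
  · exact Mode.lag_hitSecond_le _
  · rw [add_zero]
    exact Mode.lag_hitFirst_le _

theorem potential_afterAccess_of_gt (hs : s.Regular) (hA : s.AllowedStates) (hz : z ∈ s.list)
    (full : Bool) (hy : y ∈ s.list) (h : s.pos z < s.pos y) :
    (s.afterAccess z full).potential z y ≤ s.potential z y + ratio * (s.mode y z).budget := by
  have hyz := (ne_of_pos_lt h).symm
  have h1 : (s.afterAccess z full).pos z < (s.afterAccess z full).pos y :=
    (hs.pos_afterAccess_self_lt_iff hz full hyz).2 ((hs.dest_le hz full).trans h.le)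
  rw [potential_of_lt' hy hz h, potential_of_lt' ((hs.mem_afterAccess hz full).2 hy)
    ((hs.mem_afterAccess hz full).2 hz) h1, hs.mode_afterAccess_left hz hy hyz,
    hs.mode_flip hy hz hyz]
  exact stateValue_hitFirst_le (hA y hy z hz h) (hs.flavor_afterAccess_of_lt hz full hy h)

theorem potential_afterAccess_before (hs : s.Regular) (hz : z ∈ s.list)
    (full : Bool) (hy : y ∈ s.list) (hyz : y ≠ z) (h : s.dest z full ≤ s.pos y) :
    (s.afterAccess z full).potential z y =
      stateValue (s.mode y z).flip.hitFirst ((s.afterAccess z full).flavor z y) := by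
  rw [potential_of_lt' ((hs.mem_afterAccess hz full).2 hy) ((hs.mem_afterAccess hz full).2 hz)
    ((hs.pos_afterAccess_self_lt_iff hz full hyz).2 h), hs.mode_afterAccess_left hz hy hyz,
    hs.mode_flip hz hy hyz.symm]

theorem potential_afterAccess_behind (hs : s.Regular) (hz : z ∈ s.list)
    (full : Bool) (hy : y ∈ s.list) (hyz : y ≠ z) (h : s.pos y < s.dest z full) :
    (s.afterAccess z full).potential z y =
      stateValue (s.mode y z).hitSecond ((s.afterAccess z full).flavor y z) := by
  rw [potential_of_lt ((hs.mem_afterAccess hz full).2 hz) ((hs.mem_afterAccess hz full).2 hy)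
    ((hs.pos_afterAccess_lt_self_iff hz full hyz).2 h), hs.mode_afterAccess_right hz hy hyz]

/-- The contribution of an item `y` preceding `z` to the objective. -/
noncomputable def contribution (s : State α) (z : α) (full : Bool) (y : α) : ℝ :=
  1 + (if s.dest z full ≤ s.pos y then 1 else 0) +
    ((s.afterAccess z full).potential z y - s.potential z y)

/-- The partial move passes y exactly when the flavor is not d, which separates the two numerical
estimates. -/
theorem average_contribution_le (hs : s.Regular) (hA : s.AllowedStates) (hz : z ∈ s.list)
    (hy : y ∈ s.list) (h : s.pos y < s.pos z) :
    fullWeight * s.contribution z true y + (1 - fullWeight) * s.contribution z false y ≤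
      ratio * (s.mode y z).budget := by
  have hyz := ne_of_pos_lt h
  have hall := hA z hz y hy h
  have h0 : s.dest z true ≤ s.pos y := Nat.zero_le _
  rw [contribution, contribution, if_pos h0, potential_afterAccess_before hs hz true hy hyz h0,
    hs.flavor_full hz hy h, potential_of_lt hz hy h, one_add_one_eq_two]
  by_cases hf : s.flavor y z = .d
  · have hd := (hs.flavor_eq_d_iff hy).1 hf
    rw [if_neg hd.not_ge, potential_afterAccess_behind hs hz false hy hyz hd, hf, add_zero]
    rw [hf] at hall
    exact average_le_of_disjoint hall (hs.flavor_afterAccess_second hz false hy)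
  · have hd := le_of_not_gt ((hs.flavor_eq_d_iff hy).not.1 hf)
    rw [if_pos hd, potential_afterAccess_before hs hz false hy hyz hd, one_add_one_eq_two]
    exact average_le_of_not_disjoint hall (hs.flavor_partial hz hy h hf)

/-- The items preceding `z`. -/
def preceding (s : State α) (z : α) : Finset α :=
  s.list.toFinset.filter fun y => s.pos y < s.pos z

theorem mem_preceding : y ∈ s.preceding z ↔ y ∈ s.list ∧ s.pos y < s.pos z := by
  simp [preceding]

theorem Regular.sum_take (hs : s.Regular) (f : α → ℝ) :
    ((s.list.take (s.pos z)).map f).sum = ∑ y ∈ s.preceding z, f y := by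
  rw [← List.sum_toFinset f (hs.nodup.sublist (List.take_sublist _ _))]
  congr 1
  ext y
  rw [List.mem_toFinset, mem_preceding]
  constructor
  · intro h
    have := List.mem_of_mem_take h
    exact ⟨this, (List.mem_take_iff_idxOf_lt this).1 h⟩
  · rintro ⟨h1, h2⟩
    exact (List.mem_take_iff_idxOf_lt h1).2 h2

/-- Each preceding item accounts for one unit of access cost, and for one swap if z jumps over it.
-/
theorem Regular.objective_eq (hs : s.Regular) (hz : z ∈ s.list) (full : Bool) :
    s.objective z full = ∑ y ∈ s.preceding z, s.contribution z full y := by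
  have hd := hs.dest_le hz full
  have hlt := pos_lt_length hz
  have c1 : (s.preceding z).card = s.pos z := card_filter_idxOf_lt hs.nodup hlt.le
  have c2 : ((s.preceding z).filter fun y => s.pos y < s.dest z full).card = s.dest z full := by
    refine Eq.trans ?_ (card_filter_idxOf_lt hs.nodup (hd.trans hlt.le))
    congr 1
    ext y
    rw [Finset.mem_filter, mem_preceding, Finset.mem_filter, List.mem_toFinset]
    exact ⟨fun h => ⟨h.1.1, h.2⟩, fun h => ⟨⟨h.1, h.2.trans_le hd⟩, h.2⟩⟩
  have c3 := Finset.card_filter_add_card_filter_not (s := s.preceding z)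
    (fun y => s.pos y < s.dest z full)
  simp only [not_lt] at c3
  rw [objective, hs.sum_take]
  simp only [contribution, Finset.sum_add_distrib, Finset.sum_const, nsmul_eq_mul, mul_one,
    Finset.sum_boole]
  congr 1
  rw [moveCost]
  norm_cast
  omega

theorem objective_choice_le (s : State α) (z : α) (tie : Bool) :
    s.objective z (s.choice z tie) ≤
      fullWeight * s.objective z true + (1 - fullWeight) * s.objective z false := by
  have h1 := fullWeight_nonneg
  have h2 := fullWeight_le_one
  rw [choice]
  split_ifs with h3 h4
  · nlinarith
  · nlinarith
  · have : s.objective z true = s.objective z false := le_antisymm (not_lt.1 h4) (not_lt.1 h3)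
    cases tie <;> rw [this] <;> linarith

theorem amortized_preceding (hs : s.Regular) (hA : s.AllowedStates) (hz : z ∈ s.list)
    (tie : Bool) :
    s.objective z (s.choice z tie) ≤ ∑ y ∈ s.preceding z, ratio * (s.mode y z).budget := by
  refine (objective_choice_le s z tie).trans ?_
  rw [hs.objective_eq hz, hs.objective_eq hz, Finset.mul_sum, Finset.mul_sum,
    ← Finset.sum_add_distrib]
  refine Finset.sum_le_sum fun y hy => ?_
  rw [mem_preceding] at hy
  exact average_contribution_le hs hA hz hy.1 hy.2

theorem sum_payment (hs : s.Regular) (hz : z ∈ s.list) (hL : L.Perm s.list) :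
    ∑ y ∈ s.list.toFinset.erase z, payment L z y = L.idxOf z := by
  have hz' : z ∈ L := hL.mem_iff.2 hz
  have h0 : payment L z z = 0 := by simp [payment]
  rw [Finset.sum_erase _ h0, ← List.toFinset_eq_of_perm _ _ hL]
  simp only [payment, Finset.sum_boole]
  rw [card_filter_idxOf_lt (hL.nodup_iff.2 hs.nodup) (List.idxOf_lt_length_of_mem hz').le]

theorem amortized_access (hs : s.Regular) (hA : s.AllowedStates) (hz : z ∈ s.list)
    (hL : L.Perm s.list) (tie : Bool) :
    s.moveCost z (s.choice z tie) + (s.serveAccess z tie).totalPotential L ≤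
      s.totalPotential L + ratio * L.idxOf z := by
  rw [serveAccess]
  have hobj := amortized_preceding hs hA hz tie
  -- From here on, `hobj` is the only information needed about which move was chosen.
  generalize s.choice z tie = full at *
  have hp := hs.movedList_perm hz full
  have e : (s.afterAccess z full).list.toFinset = s.list.toFinset :=
    List.toFinset_eq_of_perm _ _ hp
  rw [totalPotential_eq hz hL, totalPotential_eq ((hs.mem_afterAccess hz full).2 hz)
    (hL.trans hp.symm), e, ← sum_payment hs hz hL, Finset.mul_sum]
  have h1 : ∑ q ∈ (s.list.toFinset.erase z).offDiag,
        (s.afterAccess z full).pairPotential L q.1 q.2 ≤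
      ∑ q ∈ (s.list.toFinset.erase z).offDiag, s.pairPotential L q.1 q.2 := by
    refine Finset.sum_le_sum fun q hq => ?_
    simp only [Finset.mem_offDiag, Finset.mem_erase, List.mem_toFinset] at hq
    exact pairPotential_afterAccess_le hs hA hz full hq.1.2 hq.2.1.2 hq.1.1 hq.2.1.1 hL hq.2.2
  have h2 : ∑ y ∈ s.list.toFinset.erase z, ((s.afterAccess z full).excess L z y +
      (s.mode y z).budget) ≤
      ∑ y ∈ s.list.toFinset.erase z, (s.excess L z y + payment L z y) := by
    refine Finset.sum_le_sum fun y hy => ?_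
    simp only [Finset.mem_erase, List.mem_toFinset] at hy
    exact excess_afterAccess_le hs hz full hy.2 hy.1 L
  have h3 : s.moveCost z full + ∑ y ∈ s.list.toFinset.erase z,
      ((s.afterAccess z full).potential z y - s.potential z y) ≤
      ∑ y ∈ s.list.toFinset.erase z, ratio * (s.mode y z).budget := by
    rw [objective, hs.sum_take] at hobj
    have hfil : (s.list.toFinset.erase z).filter (fun y => s.pos y < s.pos z) =
        s.preceding z := by
      ext y
      simp only [Finset.mem_filter, Finset.mem_erase, List.mem_toFinset, mem_preceding]
      constructor
      · tauto
      · exact fun h => ⟨⟨ne_of_pos_lt h.2, h.1⟩, h.2⟩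
    -- The items before z pay for the move collectively through `hobj`; each item behind z stays
    -- within its own budget.
    rw [← Finset.sum_filter_add_sum_filter_not _ (fun y => s.pos y < s.pos z),
      ← Finset.sum_filter_add_sum_filter_not (s.list.toFinset.erase z)
        (fun y => s.pos y < s.pos z) (fun y => ratio * (s.mode y z).budget), hfil, ← add_assoc]
    refine add_le_add hobj (Finset.sum_le_sum fun y hy => ?_)
    simp only [Finset.mem_filter, Finset.mem_erase, List.mem_toFinset] at hy
    obtain ⟨⟨hyz, hy⟩, h⟩ := hy
    have := potential_afterAccess_of_gt hs hA hz full hy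
      (lt_of_le_of_ne (not_lt.1 h) (pos_ne hz hyz).symm)
    linarith
  have h4 := mul_le_mul_of_nonneg_left h2 ratio_nonneg
  simp only [pairPotential, Finset.sum_add_distrib, Finset.sum_sub_distrib, ← Finset.mul_sum,
    mul_add] at h1 h3 h4 ⊢
  linarith

/-! ## Swaps, insertions and removals -/

/-- Only the pair {x, y} changes its order in the list. It occurs as two ordered pairs, each gaining
at most R, and the factor 1/2 leaves a single R. -/
theorem totalPotential_swap_le {A B : List α} (hL : (A ++ x :: y :: B).Nodup) :
    s.totalPotential (A ++ y :: x :: B) ≤ s.totalPotential (A ++ x :: y :: B) + ratio := by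
  have key : ∀ q ∈ s.list.toFinset.offDiag, s.pairPotential (A ++ y :: x :: B) q.1 q.2 ≤
      s.pairPotential (A ++ x :: y :: B) q.1 q.2 +
        ((if q = (x, y) then ratio else 0) + if q = (y, x) then ratio else 0) := by
    rintro ⟨u, v⟩ hq
    simp only [Finset.mem_offDiag] at hq
    have hR := ratio_nonneg
    by_cases h : (u = x ∧ v = y) ∨ (u = y ∧ v = x)
    · have h1 : ratio ≤ (if (u, v) = (x, y) then ratio else 0) +
          if (u, v) = (y, x) then ratio else 0 := by
        simp only [Prod.mk.injEq]
        split_ifs <;> first | linarith | tauto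
      have h2 := mul_le_mul_of_nonneg_left
        (excess_le_one (s := s) (L := A ++ y :: x :: B) (x := u) (y := v)) hR
      have h3 := mul_nonneg hR (excess_nonneg (s := s) (L := A ++ x :: y :: B) (x := u) (y := v))
      simp only [pairPotential]
      linarith
    · rw [not_or] at h
      have := idxOf_swap hL (Ne.symm hq.2.2) (fun h' => h.2 ⟨h'.2, h'.1⟩)
        (fun h' => h.1 ⟨h'.2, h'.1⟩)
      simp only [pairPotential, excess, this]
      have : (0 : ℝ) ≤ (if (u, v) = (x, y) then ratio else 0) +
          if (u, v) = (y, x) then ratio else 0 := by split_ifs <;> linarith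
      linarith
  have h := Finset.sum_le_sum key
  rw [Finset.sum_add_distrib, Finset.sum_add_distrib, Finset.sum_ite_eq', Finset.sum_ite_eq'] at h
  have hR := ratio_nonneg
  have h1 : ∀ p : Prop, ∀ _ : Decidable p, (if p then ratio else 0) ≤ ratio := by
    intro p _
    split_ifs <;> linarith
  have h2 := h1 ((x, y) ∈ s.list.toFinset.offDiag) inferInstance
  have h3 := h1 ((y, x) ∈ s.list.toFinset.offDiag) inferInstance
  simp only [totalPotential]
  linarith

theorem totalPotential_swaps_le {L L' : List α} {k : ℕ} (h : Swaps L k L') (hL : L.Nodup) :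
    s.totalPotential L' ≤ s.totalPotential L + ratio * k := by
  induction h with
  | refl => simp
  | swap A B x y k h ih =>
    have := totalPotential_swap_le (s := s) (h.perm.nodup_iff.2 hL)
    push_cast
    linarith

/-- The new item is last in both lists, so its pairs start in α^d with excess 0. -/
theorem totalPotential_insertItem (hs : s.Regular) (hz : z ∉ s.list) (hL : L.Perm s.list) :
    (s.insertItem z).totalPotential (L ++ [z]) = s.totalPotential L := by
  have hzL : z ∉ L := fun h => hz (hL.mem_iff.1 h)
  have e : (s.insertItem z).list.toFinset.erase z = s.list.toFinset := by
    ext y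
    simp only [Finset.mem_erase, List.mem_toFinset, mem_insertItem]
    constructor
    · tauto
    · intro h
      exact ⟨fun h' => hz (h' ▸ h), .inl h⟩
  rw [totalPotential_eq (mem_insertItem.2 (.inr rfl)) (hL.append_right [z]), e, totalPotential]
  have h1 : ∑ y ∈ s.list.toFinset, (s.insertItem z).pairPotential (L ++ [z]) z y = 0 := by
    refine Finset.sum_eq_zero fun y hy => ?_
    rw [List.mem_toFinset] at hy
    have hyz : y ≠ z := fun h => hz (h ▸ hy)
    have hyL := hL.mem_iff.2 hy
    have hlt : (L ++ [z]).idxOf y < (L ++ [z]).idxOf z := by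
      rw [List.idxOf_append_of_mem hyL, List.idxOf_append_of_notMem hzL]
      have := List.idxOf_lt_length_of_mem hyL
      omega
    rw [pairPotential, (potential_insertItem_self hz hy).1, excess, if_pos hlt,
      mode_insertItem_self hyz]
    simp [Mode.lag]
  rw [h1, add_zero]
  congr 1
  refine Finset.sum_congr rfl fun q hq => ?_
  simp only [Finset.mem_offDiag, List.mem_toFinset] at hq
  have hx : q.1 ≠ z := fun h => hz (h ▸ hq.1)
  have hy : q.2 ≠ z := fun h => hz (h ▸ hq.2.1)
  simp only [pairPotential, excess, hs.potential_insertItem_of_ne hx hy,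
    mode_insertItem_of_ne hx hy, mode_insertItem_of_ne hy hx,
    List.idxOf_append_of_mem (hL.mem_iff.2 hq.1), List.idxOf_append_of_mem (hL.mem_iff.2 hq.2.1)]

/-- The total runs over active pairs only, so stored values never enter it and the lost terms are
nonnegative. -/
theorem totalPotential_removeItem_le (hs : s.Regular) (hz : s.Untargeted z) :
    (s.removeItem z).totalPotential (L.erase z) ≤ s.totalPotential L := by
  rw [totalPotential, totalPotential]
  refine mul_le_mul_of_nonneg_left ?_ (by norm_num)
  have hsub : (s.removeItem z).list.toFinset.offDiag ⊆ s.list.toFinset.offDiag := by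
    refine Finset.offDiag_mono fun y hy => ?_
    rw [List.mem_toFinset] at hy ⊢
    exact (hs.mem_removeItem.1 hy).2
  refine le_trans (le_of_eq (Finset.sum_congr rfl fun q hq => ?_))
    (Finset.sum_le_sum_of_subset_of_nonneg hsub fun q hq _ => ?_)
  · simp only [Finset.mem_offDiag, List.mem_toFinset, hs.mem_removeItem] at hq
    simp only [pairPotential, excess, hs.potential_removeItem hz, mode_removeItem,
      idxOf_erase_lt_idxOf_erase hq.2.1.1 hq.1.1]
  · simp only [Finset.mem_offDiag, List.mem_toFinset] at hq
    exact pairPotential_nonneg hq.1 hq.2.1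

/-! ## Whole runs -/

theorem Regular.serveAccess_list_perm (hs : s.Regular) (hz : z ∈ s.list) (tie : Bool) :
    (s.serveAccess z tie).list.Perm s.list :=
  hs.movedList_perm hz _

theorem amortized_step {M : CostModel} {r : Request α} {c : ℕ} {L' : List α} (hs : s.Regular)
    (hA : s.AllowedStates) (hL : L.Perm s.list) (h : Step M L r c L') (tie : Bool) :
    s.stepCost M r tie + (s.step r tie).totalPotential L' ≤ s.totalPotential L + ratio * c ∧
      (s.step r tie).Regular ∧ (s.step r tie).AllowedStates ∧ L'.Perm (s.step r tie).list := by
  have hnd : L.Nodup := hL.nodup_iff.2 hs.nodup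
  have hR := one_le_ratio
  -- The two sides pay the same offsets and insertion costs, so R ≥ 1 suffices for every cost
  -- convention.
  have offset : ∀ a : ℕ, (a : ℝ) ≤ ratio * a := fun a =>
    le_mul_of_one_le_left (Nat.cast_nonneg a) hR
  cases r with
  | access z =>
    obtain ⟨hz, k, hk, rfl⟩ := h
    replace hz := hL.mem_iff.1 hz
    refine ⟨?_, hs.afterAccess hz _, hs.allowedStates_afterAccess hA hz _,
      hk.perm.trans (hL.trans (hs.serveAccess_list_perm hz tie).symm)⟩
    have h1 := amortized_access hs hA hz hL tie
    have h2 := totalPotential_swaps_le (s := s.serveAccess z tie) hk hnd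
    have h3 := offset M.accessOffset
    simp only [step, stepCost]
    push_cast
    linarith
  | insert z =>
    obtain ⟨hz, k, hk, rfl⟩ := h
    have hz' : z ∉ s.list := fun h => hz (hL.mem_iff.2 h)
    refine ⟨?_, hs.insertItem hz', hs.allowedStates_insertItem hA hz',
      hk.perm.trans (hL.append_right [z])⟩
    have h1 := totalPotential_insertItem hs hz' hL
    have h2 := totalPotential_swaps_le (s := s.insertItem z) hk
      (by simpa [List.nodup_append, hnd] using fun a ha (h : a = z) => hz (h ▸ ha))
    have h3 := offset (M.insertCost s.list.length)
    simp only [step, stepCost, hL.length_eq]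
    push_cast
    linarith
  | delete z =>
    obtain ⟨hz, k, L₁, hk, rfl, rfl⟩ := h
    replace hz := hL.mem_iff.1 hz
    have hreg : (s.serveAccess z tie).Regular := hs.afterAccess hz _
    have hunt : (s.serveAccess z tie).Untargeted z := hs.untargeted_afterAccess hz _
    refine ⟨?_, hreg.removeItem hunt,
      hreg.allowedStates_removeItem (hs.allowedStates_afterAccess hA hz _) hunt,
      (hk.perm.trans (hL.trans (hs.serveAccess_list_perm hz tie).symm)).erase z⟩
    have h1 := amortized_access hs hA hz hL tie
    have h2 := totalPotential_swaps_le (s := s.serveAccess z tie) hk hnd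
    have h3 := offset M.deleteOffset
    have h4 := totalPotential_removeItem_le (L := L₁) hreg hunt
    simp only [step, stepCost]
    push_cast
    linarith

theorem cost_le {M : CostModel} {σ : List (Request α)} {c : ℕ} {L' : List α}
    (h : Serves M L σ c L') : ∀ {s : State α} (_ : s.Regular) (_ : s.AllowedStates)
    (_ : L.Perm s.list) (tie : ℕ → Bool),
    (s.cost M tie σ : ℝ) ≤ s.totalPotential L + ratio * c := by
  induction h with
  | nil L =>
    intro s _ _ _ tie
    simpa [cost] using totalPotential_nonneg (s := s) (L := L)
  | cons L L₁ L₂ r σ c d hstep _ ih =>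
    intro s hs hA hL tie
    obtain ⟨h1, h2, h3, h4⟩ := amortized_step hs hA hL hstep (tie 0)
    have h5 := ih h2 h3 h4 fun i => tie (i + 1)
    simp only [cost]
    push_cast
    linarith

theorem _root_.ListUpdate.Valid.exists_serves (M : CostModel) {σ : List (Request α)} :
    ∀ {L : List α}, Valid L σ → ∃ c L', Serves M L σ c L' := by
  induction σ with
  | nil => exact fun _ => ⟨_, _, .nil _⟩
  | cons r σ ih =>
    intro L h
    cases r with
    | access z =>
      obtain ⟨c, L', h'⟩ := ih h.2
      exact ⟨_, _, .cons _ _ _ _ _ _ _ ⟨h.1, 0, .refl _, rfl⟩ h'⟩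
    | insert z =>
      obtain ⟨c, L', h'⟩ := ih h.2
      exact ⟨_, _, .cons _ _ _ _ _ _ _ ⟨h.1, 0, .refl _, rfl⟩ h'⟩
    | delete z =>
      obtain ⟨c, L', h'⟩ := ih h.2
      exact ⟨_, _, .cons _ _ _ _ _ _ _ ⟨h.1, 0, _, .refl _, rfl, rfl⟩ h'⟩

theorem cost_initial_le (M : CostModel) {L : List α} (hL : L.Nodup) {σ : List (Request α)}
    (hσ : Valid L σ) (tie : ℕ → Bool) :
    ((initial L).cost M tie σ : ℝ) ≤ ratio * opt M L σ := by
  -- Nonemptiness makes `opt` an attained cost rather than the default infimum 0.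
  have hne : {c | ∃ L', Serves M L σ c L'}.Nonempty := hσ.exists_serves M
  obtain ⟨L', h⟩ := Nat.sInf_mem hne
  have := cost_le h (regular_initial hL) allowedStates_initial (List.Perm.refl L) tie
  rwa [totalPotential_initial, zero_add] at this

theorem regular_run {M : CostModel} {σ : List (Request α)} {c : ℕ} {L' : List α}
    (h : Serves M L σ c L') : ∀ {s : State α} (_ : s.Regular) (_ : s.AllowedStates)
    (_ : L.Perm s.list) (tie : ℕ → Bool), (s.run tie σ).Regular := by
  induction h with
  | nil L => exact fun hs _ _ _ => hs
  | cons L L₁ L₂ r σ c d hstep _ ih =>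
    intro s hs hA hL tie
    obtain ⟨-, h2, h3, h4⟩ := amortized_step hs hA hL hstep (tie 0)
    exact ih h2 h3 h4 _

theorem regular_run_initial {L : List α} (hL : L.Nodup) {σ : List (Request α)}
    (hσ : Valid L σ) (tie : ℕ → Bool) : ((initial L).run tie σ).Regular := by
  -- Any cost model would do: the solution only witnesses that the requests can be served.
  obtain ⟨c, L', h⟩ := hσ.exists_serves ⟨0, 0, fun _ => 0⟩
  exact regular_run h (regular_initial hL) allowedStates_initial (List.Perm.refl L) tie

/-- The item `z` is absent, and no pair containing it stores a potential. -/
def Fresh (s : State α) (z : α) : Prop :=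
  z ∉ s.list ∧ ∀ y, s.stored z y = 0 ∧ s.stored y z = 0

theorem Fresh.serveAccess (hz : s.Fresh z) (hs : s.Regular) (hx : x ∈ s.list) (tie : Bool) :
    (s.serveAccess x tie).Fresh z :=
  ⟨fun h => hz.1 ((hs.serveAccess_list_perm hx tie).mem_iff.1 h), hz.2⟩

theorem Fresh.insertItem (hz : s.Fresh z) (hxz : x ≠ z) : (s.insertItem x).Fresh z := by
  refine ⟨fun h => ?_, hz.2⟩
  rcases mem_insertItem.1 h with h | h
  · exact hz.1 h
  · exact hxz h.symm

theorem Fresh.removeItem (hz : s.Fresh z) : (s.removeItem x).Fresh z := by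
  refine ⟨fun h => hz.1 (List.mem_of_mem_erase h), fun y => ⟨?_, ?_⟩⟩
  · exact (if_neg fun h => hz.1 h.1).trans (hz.2 y).1
  · exact (if_neg fun h => hz.1 h.2).trans (hz.2 y).2

theorem fresh_run {M : CostModel} {σ : List (Request α)} {c : ℕ} {L' : List α}
    (h : Serves M L σ c L') : ∀ {s : State α} (_ : s.Regular) (_ : s.AllowedStates)
    (_ : L.Perm s.list) (_ : s.Fresh z) (_ : Request.insert z ∉ σ) (tie : ℕ → Bool),
    (s.run tie σ).Fresh z := by
  induction h with
  | nil L => exact fun _ _ _ hz _ _ => hz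
  | cons L L₁ L₂ r σ c d hstep _ ih =>
    intro s hs hA hL hz hσ tie
    obtain ⟨-, h2, h3, h4⟩ := amortized_step hs hA hL hstep (tie 0)
    rw [List.mem_cons, not_or] at hσ
    refine ih h2 h3 h4 ?_ hσ.2 _
    cases r with
    | access x => exact hz.serveAccess hs (hL.mem_iff.1 hstep.1) _
    | insert x => exact hz.insertItem fun h => hσ.1 (h ▸ rfl)
    | delete x => exact (hz.serveAccess hs (hL.mem_iff.1 hstep.1) _).removeItem

theorem fresh_run_initial {L : List α} (hL : L.Nodup) {σ : List (Request α)}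
    (hσ : Valid L σ) (hz : z ∉ L) (hzσ : Request.insert z ∉ σ) (tie : ℕ → Bool) :
    ((initial L).run tie σ).Fresh z := by
  obtain ⟨c, L', h⟩ := hσ.exists_serves ⟨0, 0, fun _ => 0⟩
  exact fresh_run h (regular_initial hL) allowedStates_initial (List.Perm.refl L)
    ⟨hz, fun _ => ⟨rfl, rfl⟩⟩ hzσ tie

/-- For a pair containing z the old value is the stored 0. If the partner is present, the pair
becomes active in α^d, again 0; if it is absent, the stored 0 remains. -/
theorem Fresh.potential_insertItem (hz : s.Fresh z) (hs : s.Regular) (hxy : x ≠ y) :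
    (s.insertItem z).potential x y = s.potential x y := by
  by_cases hx : x = z
  · subst hx
    have h0 : s.potential x y = 0 := (if_neg fun h => hz.1 h.1).trans (hz.2 y).1
    by_cases hy : y ∈ s.list
    · rw [h0, (potential_insertItem_self hz.1 hy).1]
    · rw [h0, ← (hz.2 y).1]
      exact if_neg fun h => (mem_insertItem.1 h.2).elim hy hxy.symm
  by_cases hy : y = z
  · subst hy
    have h0 : s.potential x y = 0 := (if_neg fun h => hz.1 h.2).trans (hz.2 x).2
    by_cases hx' : x ∈ s.list
    · rw [h0, (potential_insertItem_self hz.1 hx').2]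
    · rw [h0, ← (hz.2 x).2]
      exact if_neg fun h => (mem_insertItem.1 h.1).elim hx' hxy
  · exact hs.potential_insertItem_of_ne hx hy

end State

end ListUpdate

theorem mainTheorem2 {α : Type*} [DecidableEq α] (L₀ : List α) (hL₀ : L₀.Nodup)
    (σ : List (ListUpdate.Request α)) (hσ : ListUpdate.Valid L₀ σ) (tie : ℕ → Bool) :
    (∀ M : ListUpdate.CostModel,
      (((ListUpdate.State.initial L₀).cost M tie σ : ℕ) : ℝ) ≤
        (23 + √17) / 8 * (ListUpdate.opt M L₀ σ : ℝ)) ∧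
    (23 + √17) / 8 ≤ (3.3904 : ℝ) ∧
    (∀ z : α, z ∉ L₀ → ListUpdate.Request.insert z ∉ σ → ∀ x y : α, x ≠ y →
      (((ListUpdate.State.initial L₀).run tie σ).insertItem z).potential x y =
        ((ListUpdate.State.initial L₀).run tie σ).potential x y) ∧
    (∀ z : α, z ∈ ((ListUpdate.State.initial L₀).run tie σ).list → ∀ (b : Bool) (x y : α), x ≠ y →
      ((((ListUpdate.State.initial L₀).run tie σ).serveAccess z b).removeItem z).potential x y =
        (((ListUpdate.State.initial L₀).run tie σ).serveAccess z b).potential x y) := by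
  have hreg := ListUpdate.State.regular_run_initial hL₀ hσ tie
  refine ⟨fun M => ListUpdate.State.cost_initial_le M hL₀ hσ tie, ?_, ?_, ?_⟩
  · have := ListUpdate.sqrt_seventeen_lt
    linarith
  · intro z hz hzσ x y hxy
    exact (ListUpdate.State.fresh_run_initial hL₀ hσ hz hzσ tie).potential_insertItem hreg hxy
  · intro z hz b x y _
    exact (hreg.afterAccess hz _).potential_removeItem (hreg.untargeted_afterAccess hz _)
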